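/- For $\theta\in\mathbb{T}_{2\pi}=\mathbb{R}/2\pi\mathbb{Z}$ let $\mathbf{u}(\theta)=(\cos\theta,\sin\theta)$ and let $\sigma_\theta$ be the counterclockwise rotation of $\mathbb{R}^2$ by $\theta$. For $\delta\ge 0$ and a bounded set $\Omega\subset\mathbb{R}^2$ put $[\delta,\theta]\Omega=\delta\,\sigma_\theta\Omega$ and $\widehat{\mathbb 1}_\Omega(\boldsymbol\xi)=\int_\Omega e^{-2\pi i\,\mathbf{x}\cdot\boldsymbol\xi}\,d\mathbf{x}$. A planar convex body is a bounded convex set $C\subset\mathbb{R}^2$ with non-empty interior. For $\mathbf{p}\in\partial C$ let $$\nu_C(\mathbf{p})=\Big\{\theta\in\mathbb{T}_{2\pi}\,:\,\min_{\mathbf{a}\in\overline{C}}\mathbf{a}\cdot\mathbf{u}(\theta)=\mathbf{p}\cdot\mathbf{u}(\theta)\Big\},\qquad \mathcal{T}_C=\bigcup_{\mathbf{p}\in\partial C}\mathrm{int}\,\nu_C(\mathbf{p}),$$ where $\mathrm{int}$ denotes the interior in $\mathbb{T}_{2\pi}$. Let $\psi_C$ be the maximal length of a connected component of $\mathcal{T}_C\cap(\mathcal{T}_C+\pi)$,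 with $\psi_C=0$ if this set is empty. Lemma. Let $C\subset\mathbb{R}^2$ be a planar convex body and let $I\subseteq\mathbb{T}_{2\pi}$ be an interval of angles (the image of an interval of $\mathbb{R}$, of any kind) whose length $|I|$ satisfies $\psi_C<|I|\le 2\pi$. Then there are constants $c_1,c_2,\rho_0>0$, depending only on $C$ and $I$, such that for every $\omega\in\mathbb{T}_{2\pi}$ and every $\rho\ge\rho_0$, $$c_1\,\rho^{-3}\;\le\;\int_I\int_0^1\left|\widehat{\mathbb 1}_{[\delta,\theta]C}(\rho\,\mathbf{u}(\omega))\right|^2\,d\delta\,d\theta\;\le\; c_2\,\rho^{-3}.$$ -/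

import Mathlib

open MeasureTheory
open scoped Real FourierTransform ENNReal

noncomputable section

/-- The Euclidean plane. -/
abbrev Plane : Type := EuclideanSpace ℝ (Fin 2)

instance factTwoPiPos : Fact (0 < 2 * π) := ⟨Real.two_pi_pos⟩

/-- The circle of angles `ℝ / 2πℤ`; its `volume` is arc length, of total mass `2π`. -/
abbrev AngleCircle : Type := AddCircle (2 * π)

/-- Cosine of an angle. -/
def angleCos (θ : AngleCircle) : ℝ := Real.cos_periodic.lift θ

/-- Sine of an angle. -/
def angleSin (θ : AngleCircle) : ℝ := Real.sin_periodic.lift θ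

/-- The unit vector `u(θ) = (cos θ, sin θ)`. -/
def unitVec (θ : AngleCircle) : Plane := !₂[angleCos θ, angleSin θ]

/-- The counterclockwise rotation of the plane by the angle `θ`. -/
def rotate (θ : AngleCircle) (x : Plane) : Plane :=
  !₂[angleCos θ * x 0 - angleSin θ * x 1, angleSin θ * x 0 + angleCos θ * x 1]

/-- The set `[δ, θ]Ω`: `Ω` rotated by `θ` and then dilated by `δ`. -/
def dilateRotate (δ : ℝ) (θ : AngleCircle) (Ω : Set Plane) : Set Plane :=
  (fun x => δ • rotate θ x) '' Ω

/-- The Fourier transform of the characteristic function of `Ω`,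
`ξ ↦ ∫_Ω exp(-2πi x·ξ) dx`. -/
def fourierIndicator (Ω : Set Plane) (ξ : Plane) : ℂ :=
  𝓕 (Ω.indicator fun _ => (1 : ℂ)) ξ

/-- A planar convex body: a bounded convex set with non-empty interior
(it need not be closed). -/
structure IsPlanarConvexBody (C : Set Plane) : Prop where
  convex : Convex ℝ C
  bounded : Bornology.IsBounded C
  nonempty_interior : (interior C).Nonempty

/-- The set of normals of `C` at a point `p` of its boundary: the angles `θ` for which the minimum
of `a ↦ a · u(θ)` over `C` equals `p · u(θ)`. As `C` need not be closed, the minimum is taken over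
the closure of `C`, where it is attained; it is the infimum over `C`. -/
def normalAngles (C : Set Plane) (p : Plane) : Set AngleCircle :=
  {θ | IsLeast ((fun a => inner ℝ a (unitVec θ)) '' closure C) (inner ℝ p (unitVec θ))}

/-- The angular trace of `C`: the union, over the points of the boundary of `C`, of the interiors
(in the circle of angles) of the sets of normals. The arc-length parametrization only serves to
list the boundary points, so the union is indexed by the points themselves. -/
def angularTrace (C : Set Plane) : Set AngleCircle :=
  ⋃ p ∈ frontier C, interior (normalAngles C p)

/-- The set `T ∩ (T + π)`, where `T` is the angular trace of `C`. -/
def symmetricTrace (C : Set Plane) : Set AngleCircle :=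
  angularTrace C ∩ (fun θ => θ + ((π : ℝ) : AngleCircle)) '' angularTrace C

/-- The symmetric angular threshold `ψ_C`: the largest length of a connected component of
`T ∩ (T + π)`, and `0` if this set is empty. (The components are disjoint open arcs of total
length at most `2π`, so the supremum is a maximum.) -/
def symmetricAngularThreshold (C : Set Plane) : ℝ≥0∞ :=
  ⨆ θ ∈ symmetricTrace C, volume (connectedComponentIn (symmetricTrace C) θ)

/-- An interval of angles: the image in the circle of an interval of the real line (of any kind:
open, closed, half-open, possibly covering the whole circle). -/
def IsAngleInterval (I : Set AngleCircle) : Prop :=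
  ∃ J : Set ℝ, J.OrdConnected ∧ I = (fun t : ℝ => (t : AngleCircle)) '' J

/-- The average `∫_I ∫_0^1 |F_{δ,θ}(ρ u(ω))|² dδ dθ`, with `F_{δ,θ}` the Fourier transform of the
characteristic function of `[δ, θ]C`. -/
def fourierAverage (C : Set Plane) (I : Set AngleCircle) (ω : AngleCircle) (ρ : ℝ) : ℝ :=
  ∫ θ in I, ∫ δ in (0 : ℝ)..1,
    ‖fourierIndicator (dilateRotate δ θ C) (ρ • unitVec ω)‖ ^ 2

end

/-! ### Angles, unit vectors and rotations -/

/-! Rotation and dilation of $C$ turn the average into $\int_I E(\omega-\theta)\,d\theta$, where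
$E(\varphi)=\int_0^1\delta^4|\widehat{\mathbb 1}_C(\delta\rho\,\mathbf u(\varphi))|^2\,d\delta$ is
`radialEnergy`. Since a convex set has null frontier, $C$ may be replaced by its closure $K$.

Upper bound. The whole circle already has energy $O(\rho^{-3})$. By Plancherel, the difference of
$\mathbb 1_K$ and its translate by $(2\rho)^{-1}\mathbf e_i$ has transform $(e^{2\pi i\,\mathbf
h\cdot\boldsymbol\xi}-1)\widehat{\mathbb 1}_K(\boldsymbol\xi)$. At $\rho\boldsymbol\xi$ with
$|\boldsymbol\xi|\le1$ the factor is at least $2|\xi_i|$ in modulus, while the difference lives on a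
set of measure $O(\rho^{-1})$ because lines meet $K$ in intervals. Summing over $i$ and passing to
polar coordinates gives `lintegral_radialEnergy_le`.

Lower bound. The heart is `exists_lintegral_radialEnergy_ge`: if $\theta\notin\mathcal T_C$, every
arc around $\theta$ carries energy at least $cR^{-3}$. Indeed, no support point in direction
$\theta$ remains one for all nearby directions, so $\partial C$ contains a nondegenerate arc whose
slopes relative to $\mathbf u(\theta)^\perp$ are as small as desired
(`exists_hasFlatGraph_of_notMem_angularTrace`). Take a bump $\chi$ near $\tfrac12\mathbf u(\theta)$,
with inverse transform $v$. Along the corresponding piece of $\partial(RK)$, of length comparable to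
$R$, the convolution $\mathbb 1_{RK}*v$ is close to an integral of $v$ over a half plane. Such
integrals do not all vanish, since $\chi(\tfrac12\mathbf u(\theta))\ne0$. Hence $\|\mathbb
1_{RK}*v\|_2^2\ge cR$; Plancherel and scaling by $R^4$ give $R^{-3}$.

Since $\mathbb 1_C$ is real, $E$ is $\pi$-periodic, so it suffices that $\theta\notin\mathcal
T_C\cap(\mathcal T_C+\pi)$. An arc longer than $\psi_C$ cannot lie in one component of this open
set, so it meets the compact complement; finitely many small arcs cover that complement and make the
constants uniform in $\omega$. -/

@[simp] lemma angleCos_coe (t : ℝ) : angleCos (t : AngleCircle) = Real.cos t := rfl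

@[simp] lemma angleSin_coe (t : ℝ) : angleSin (t : AngleCircle) = Real.sin t := rfl

lemma continuous_angleCos : Continuous angleCos :=
  Real.continuous_cos.quotient_lift _

lemma continuous_angleSin : Continuous angleSin :=
  Real.continuous_sin.quotient_lift _

@[simp] lemma unitVec_apply_zero (θ : AngleCircle) : unitVec θ 0 = angleCos θ := rfl

@[simp] lemma unitVec_apply_one (θ : AngleCircle) : unitVec θ 1 = angleSin θ := rfl

@[simp] lemma rotate_apply_zero (θ : AngleCircle) (x : Plane) :
    rotate θ x 0 = angleCos θ * x 0 - angleSin θ * x 1 := rfl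

@[simp] lemma rotate_apply_one (θ : AngleCircle) (x : Plane) :
    rotate θ x 1 = angleSin θ * x 0 + angleCos θ * x 1 := rfl

lemma plane_ext {x y : Plane} (h₀ : x 0 = y 0) (h₁ : x 1 = y 1) : x = y := by
  ext i; fin_cases i <;> assumption

lemma continuous_unitVec : Continuous unitVec := by
  unfold unitVec
  refine (PiLp.continuous_toLp 2 _).comp (continuous_pi fun i => ?_)
  fin_cases i
  · exact continuous_angleCos
  · exact continuous_angleSin

lemma angleCos_sq_add_angleSin_sq (θ : AngleCircle) : angleCos θ ^ 2 + angleSin θ ^ 2 = 1 := by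
  induction θ using QuotientAddGroup.induction_on with
  | H t => exact Real.cos_sq_add_sin_sq t

lemma angleCos_add (θ φ : AngleCircle) :
    angleCos (θ + φ) = angleCos θ * angleCos φ - angleSin θ * angleSin φ := by
  induction θ using QuotientAddGroup.induction_on with
  | H t =>
  induction φ using QuotientAddGroup.induction_on with
  | H s => exact Real.cos_add t s

lemma angleSin_add (θ φ : AngleCircle) :
    angleSin (θ + φ) = angleSin θ * angleCos φ + angleCos θ * angleSin φ := by
  induction θ using QuotientAddGroup.induction_on with
  | H t =>
  induction φ using QuotientAddGroup.induction_on with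
  | H s => exact Real.sin_add t s

lemma inner_plane (x y : Plane) : inner ℝ x y = x 0 * y 0 + x 1 * y 1 := by
  simp [PiLp.inner_apply, Fin.sum_univ_two, mul_comm]

lemma norm_sq_plane (x : Plane) : ‖x‖ ^ 2 = x 0 ^ 2 + x 1 ^ 2 := by
  rw [EuclideanSpace.norm_sq_eq]; simp [Fin.sum_univ_two]

@[simp] lemma norm_unitVec (θ : AngleCircle) : ‖unitVec θ‖ = 1 := by
  have h := norm_sq_plane (unitVec θ)
  rw [unitVec_apply_zero, unitVec_apply_one, angleCos_sq_add_angleSin_sq] at h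
  nlinarith [norm_nonneg (unitVec θ)]

lemma unitVec_injective : Function.Injective unitVec := by
  intro θ φ h
  have h₀ : angleCos θ = angleCos φ := congrArg (fun x : Plane => x 0) h
  have h₁ : angleSin θ = angleSin φ := congrArg (fun x : Plane => x 1) h
  induction θ using QuotientAddGroup.induction_on with
  | H t =>
  induction φ using QuotientAddGroup.induction_on with
  | H s => exact Real.Angle.cos_sin_inj h₀ h₁

lemma unitVec_add_pi (θ : AngleCircle) : unitVec (θ + ((π : ℝ) : AngleCircle)) = -unitVec θ := by
  apply plane_ext <;> simp [angleCos_add, angleSin_add]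

lemma rotate_unitVec (θ φ : AngleCircle) : rotate θ (unitVec φ) = unitVec (θ + φ) := by
  apply plane_ext <;> simp [angleCos_add, angleSin_add]

lemma rotate_rotate (θ φ : AngleCircle) (x : Plane) :
    rotate θ (rotate φ x) = rotate (θ + φ) x := by
  apply plane_ext <;> simp [angleCos_add, angleSin_add] <;> ring

lemma rotate_zero (x : Plane) : rotate 0 x = x := by
  have h₀ : angleCos 0 = 1 := Real.cos_zero
  have h₁ : angleSin 0 = 0 := Real.sin_zero
  apply plane_ext <;> simp [h₀, h₁]

lemma norm_rotate (θ : AngleCircle) (x : Plane) : ‖rotate θ x‖ = ‖x‖ := by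
  rw [← sq_eq_sq₀ (norm_nonneg _) (norm_nonneg _), norm_sq_plane, norm_sq_plane,
    rotate_apply_zero, rotate_apply_one]
  linear_combination (x 0 ^ 2 + x 1 ^ 2) * angleCos_sq_add_angleSin_sq θ

/-- The rotation by `θ` as a linear isometry. -/
noncomputable def rotateIso (θ : AngleCircle) : Plane ≃ₗᵢ[ℝ] Plane where
  toFun := rotate θ
  invFun := rotate (-θ)
  map_add' x y := by apply plane_ext <;> simp <;> ring
  map_smul' c x := by apply plane_ext <;> simp <;> ring
  left_inv x := by rw [rotate_rotate, neg_add_cancel, rotate_zero]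
  right_inv x := by rw [rotate_rotate, add_neg_cancel, rotate_zero]
  norm_map' x := norm_rotate θ x

@[simp] lemma rotateIso_apply (θ : AngleCircle) (x : Plane) : rotateIso θ x = rotate θ x := rfl

@[simp] lemma rotateIso_symm_apply (θ : AngleCircle) (x : Plane) :
    (rotateIso θ).symm x = rotate (-θ) x := rfl

/-! ### Elementary properties of the Fourier transform of an indicator function -/

lemma fourierIndicator_eq (Ω : Set Plane) (ξ : Plane) :
    fourierIndicator Ω ξ =
      ∫ x, Complex.exp (((-2 * π * inner ℝ x ξ : ℝ) : ℂ) * Complex.I) •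
        Ω.indicator (fun _ => (1 : ℂ)) x :=
  Real.fourier_eq' _ _

lemma fourierIndicator_rotate (θ : AngleCircle) (C : Set Plane) (ξ : Plane) :
    fourierIndicator (rotate θ '' C) ξ = fourierIndicator C (rotate (-θ) ξ) := by
  have h := Real.fourier_comp_linearIsometry (rotateIso θ).symm (C.indicator fun _ => (1 : ℂ)) ξ
  rw [rotateIso_symm_apply] at h
  unfold fourierIndicator
  rw [← h]
  refine congrArg (fun g : Plane → ℂ => 𝓕 g ξ) (funext fun x => ?_)
  have hx : x ∈ rotate θ '' C ↔ rotate (-θ) x ∈ C := by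
    constructor
    · rintro ⟨y, hy, rfl⟩
      rwa [rotate_rotate, neg_add_cancel, rotate_zero]
    · intro h
      exact ⟨_, h, by rw [rotate_rotate, add_neg_cancel, rotate_zero]⟩
  rw [Function.comp_apply, rotateIso_symm_apply]
  by_cases hx' : rotate (-θ) x ∈ C
  · rw [Set.indicator_of_mem hx', Set.indicator_of_mem (hx.2 hx')]
  · rw [Set.indicator_of_notMem hx', Set.indicator_of_notMem (fun h => hx' (hx.1 h))]

lemma fourierIndicator_smul {δ : ℝ} (hδ : 0 < δ) (C : Set Plane) (ξ : Plane) :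
    fourierIndicator ((fun x => δ • x) '' C) ξ = (δ : ℂ) ^ 2 * fourierIndicator C (δ • ξ) := by
  rw [fourierIndicator_eq, fourierIndicator_eq]
  have h := Measure.integral_comp_inv_smul (volume : Measure Plane)
    (fun x => Complex.exp (((-2 * π * inner ℝ x (δ • ξ) : ℝ) : ℂ) * Complex.I) •
        C.indicator (fun _ => (1 : ℂ)) x) δ
  have hd : |δ ^ Module.finrank ℝ Plane| = δ ^ 2 := by
    rw [finrank_euclideanSpace, Fintype.card_fin, abs_of_pos (by positivity)]
  rw [hd, Complex.real_smul, Complex.ofReal_pow] at h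
  rw [← h]
  congr 1
  ext x
  have hx : x ∈ (fun x => δ • x) '' C ↔ δ⁻¹ • x ∈ C := by
    constructor
    · rintro ⟨y, hy, rfl⟩
      simpa [smul_smul, hδ.ne'] using hy
    · intro h
      exact ⟨_, h, by simp [smul_smul, hδ.ne']⟩
  have hi : inner ℝ (δ⁻¹ • x) (δ • ξ) = inner ℝ x ξ := by
    rw [real_inner_smul_left, real_inner_smul_right, ← mul_assoc, inv_mul_cancel₀ hδ.ne', one_mul]
  rw [hi]
  by_cases hx' : δ⁻¹ • x ∈ C
  · rw [Set.indicator_of_mem hx', Set.indicator_of_mem (hx.2 hx')]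
  · rw [Set.indicator_of_notMem hx', Set.indicator_of_notMem (fun h => hx' (hx.1 h))]

lemma fourierIndicator_dilateRotate {δ : ℝ} (hδ : 0 < δ) (θ ω : AngleCircle) (C : Set Plane)
    (ρ : ℝ) : fourierIndicator (dilateRotate δ θ C) (ρ • unitVec ω) =
      (δ : ℂ) ^ 2 * fourierIndicator C ((δ * ρ) • unitVec (ω - θ)) := by
  have h : dilateRotate δ θ C = (fun x => δ • x) '' (rotate θ '' C) := by
    rw [Set.image_image]; rfl
  rw [h, fourierIndicator_smul hδ, fourierIndicator_rotate, smul_smul]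
  congr 2
  rw [← rotateIso_apply, map_smul, rotateIso_apply, rotate_unitVec, neg_add_eq_sub]

lemma fourierIndicator_congr_ae {C D : Set Plane} (h : C =ᵐ[volume] D) :
    fourierIndicator C = fourierIndicator D := by
  ext ξ
  exact Real.fourier_congr_ae (indicator_ae_eq_of_ae_eq_set h) ξ

/-- The indicator is real, so opposite frequencies carry conjugate values. This is why only
$\mathcal T_C\cap(\mathcal T_C+\pi)$ matters. -/
lemma norm_fourierIndicator_neg (C : Set Plane) (ξ : Plane) :
    ‖fourierIndicator C (-ξ)‖ = ‖fourierIndicator C ξ‖ := by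
  have h : fourierIndicator C (-ξ) = starRingEnd ℂ (fourierIndicator C ξ) := by
    rw [fourierIndicator_eq, fourierIndicator_eq, ← integral_conj]
    congr 1
    ext x
    rw [smul_eq_mul, smul_eq_mul, map_mul, ← Complex.exp_conj]
    congr 1
    · simp [Complex.conj_ofNat]
    · by_cases hx : x ∈ C <;> simp [hx]
  rw [h, RCLike.norm_conj]

/-! ### Coordinates and polar coordinates in the plane -/

/-- The plane in Cartesian coordinates. -/
noncomputable def planeEquiv : ℝ × ℝ ≃ᵐ Plane :=
  MeasurableEquiv.finTwoArrow.symm.trans (MeasurableEquiv.toLp 2 (Fin 2 → ℝ))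

lemma measurePreserving_planeEquiv : MeasurePreserving planeEquiv :=
  (PiLp.volume_preserving_toLp (Fin 2)).comp (volume_preserving_finTwoArrow ℝ).symm

lemma continuous_planeEquiv : Continuous planeEquiv := by
  refine (PiLp.continuous_toLp 2 _).comp (continuous_pi fun i => ?_)
  fin_cases i
  · exact continuous_fst
  · exact continuous_snd

lemma lintegral_plane (f : Plane → ℝ≥0∞) : ∫⁻ x, f x = ∫⁻ p : ℝ × ℝ, f !₂[p.1, p.2] :=
  (measurePreserving_planeEquiv.lintegral_comp_emb planeEquiv.measurableEmbedding f).symm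

lemma lintegral_plane_polar {f : Plane → ℝ≥0∞} (hf : Measurable f) :
    ∫⁻ x, f x =
      ∫⁻ φ : AngleCircle, ∫⁻ r in Set.Ioi (0 : ℝ), ENNReal.ofReal r * f (r • unitVec φ) := by
  rw [lintegral_plane, ← lintegral_comp_polarCoord_symm, polarCoord_target,
    Measure.volume_eq_prod, ← Measure.prod_restrict]
  have hm : Measurable fun p : ℝ × ℝ =>
      ENNReal.ofReal p.1 • f !₂[(polarCoord.symm p).1, (polarCoord.symm p).2] := by
    refine Measurable.smul (ENNReal.measurable_ofReal.comp measurable_fst) ?_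
    exact hf.comp (planeEquiv.measurable.comp continuous_polarCoord_symm.measurable)
  rw [lintegral_prod_symm _ hm.aemeasurable, restrict_Ioo_eq_restrict_Ioc]
  rw [← AddCircle.lintegral_preimage (2 * π) (-π)]
  have hpi : -π + 2 * π = π := by ring
  rw [hpi]
  refine lintegral_congr fun φ => lintegral_congr fun r => ?_
  rw [smul_eq_mul]
  congr 2
  apply plane_ext <;> simp [polarCoord_symm_apply]

/-! ### Plancherel's theorem for `L¹ ∩ L²` -/

section Plancherel

open scoped SchwartzMap

variable {V : Type*} [NormedAddCommGroup V] [InnerProductSpace ℝ V] [FiniteDimensional ℝ V]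
  [MeasurableSpace V] [BorelSpace V]

lemma integral_schwartz_smul_fourier {f : V → ℂ} (hf : Integrable f) (g : 𝓢(V, ℂ)) :
    ∫ ξ, g ξ • 𝓕 f ξ = ∫ x, 𝓕 g x • f x := by
  have h := VectorFourier.integral_fourierIntegral_smul_eq_flip (L := innerₗ V)
    Real.continuous_fourierChar continuous_inner hf g.integrable (μ := volume) (ν := volume)
  simp only [smul_eq_mul, flip_innerₗ] at h ⊢
  have h' : ∫ ξ, 𝓕 f ξ * g ξ = ∫ x, f x * 𝓕 (⇑g) x := h
  simpa only [mul_comm, SchwartzMap.fourier_coe] using! h'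

/-- Tested against a smooth compactly supported $g$, both transforms give $\int\widehat g\,f$; this
determines a locally integrable function almost everywhere. -/
lemma fourier_ae_eq_fourier_toLp {f : V → ℂ} (hf : Integrable f) (hf2 : MemLp f 2) :
    𝓕 f =ᵐ[volume] ((𝓕 (hf2.toLp f) : Lp ℂ 2 (volume : Measure V)) : V → ℂ) := by
  have hcont : Continuous (𝓕 f) := by
    exact VectorFourier.fourierIntegral_continuous Real.continuous_fourierChar
      (by exact continuous_inner) hf
  refine ae_eq_of_integral_contDiff_smul_eq hcont.locallyIntegrable
    ((Lp.memLp _).locallyIntegrable (by norm_num)) fun g hg hgc => ?_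
  have hg' : HasCompactSupport (fun x => (g x : ℂ)) := hgc.comp_left (g := Complex.ofReal) rfl
  have hgs : ContDiff ℝ (⊤ : ℕ∞) (fun x => (g x : ℂ)) := Complex.ofRealCLM.contDiff.comp hg
  set G : 𝓢(V, ℂ) := hg'.toSchwartzMap hgs with hG
  have hGx : ∀ x, G x = (g x : ℂ) := fun x => rfl
  have h1 := integral_schwartz_smul_fourier hf G
  have h2 := congrArg (fun T => T G) (Lp.fourier_toTemperedDistribution_eq (hf2.toLp f))
  simp only [TemperedDistribution.fourier_apply, Lp.toTemperedDistribution_apply] at h2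
  have h3 : ∫ x, 𝓕 G x • (hf2.toLp f) x = ∫ x, 𝓕 G x • f x := by
    refine integral_congr_ae ?_
    filter_upwards [hf2.coeFn_toLp] with x hx
    rw [hx]
  simp only [hGx, smul_eq_mul] at h1 h2 h3
  simp only [Complex.real_smul]
  rw [h1, ← h2, ← h3]

theorem lintegral_enorm_sq_fourier {f : V → ℂ} (hf : Integrable f) (hf2 : MemLp f 2) :
    ∫⁻ ξ, ‖𝓕 f ξ‖ₑ ^ 2 = ∫⁻ x, ‖f x‖ₑ ^ 2 := by
  have h2 : ∀ g : V → ℂ, ∫⁻ x, ‖g x‖ₑ ^ 2 = eLpNorm g 2 volume ^ 2 := fun g => by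
    rw [eLpNorm_eq_lintegral_rpow_enorm_toReal (by norm_num) (by norm_num)]
    simp only [ENNReal.toReal_ofNat, ENNReal.rpow_ofNat, one_div]
    rw [← ENNReal.rpow_natCast, ← ENNReal.rpow_mul]
    norm_num
  rw [h2, h2]
  congr 1
  rw [eLpNorm_congr_ae (fourier_ae_eq_fourier_toLp hf hf2),
    ← eLpNorm_congr_ae hf2.coeFn_toLp, ← ENNReal.toReal_eq_toReal_iff' (Lp.eLpNorm_ne_top _)
      (Lp.eLpNorm_ne_top _), ← Lp.norm_def, ← Lp.norm_def, Lp.norm_fourier_eq]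

lemma memLp_two_of_integrable_of_bound {α : Type*} [MeasurableSpace α] {μ : Measure α}
    {f : α → ℂ} (hf : Integrable f μ) {B : ℝ} (hB : ∀ x, ‖f x‖ ≤ B) : MemLp f 2 μ := by
  rw [memLp_two_iff_integrable_sq_norm hf.1]
  refine (hf.norm.const_mul B).mono' (hf.1.norm.pow 2) (Filter.Eventually.of_forall fun x => ?_)
  rw [Real.norm_of_nonneg (by positivity), sq]
  exact mul_le_mul_of_nonneg_right (hB x) (norm_nonneg _)

end Plancherel

/-! ### Continuity of the Fourier transform of an indicator function -/

lemma integrable_indicator_one {K : Set Plane} (hK : NullMeasurableSet K)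
    (hb : Bornology.IsBounded K) : Integrable (K.indicator fun _ => (1 : ℂ)) := by
  exact IntegrableOn.integrable_indicator₀ (integrableOn_const hb.measure_lt_top.ne) hK

lemma continuous_fourierIndicator {K : Set Plane} (hK : NullMeasurableSet K)
    (hb : Bornology.IsBounded K) : Continuous (fourierIndicator K) :=
  VectorFourier.fourierIntegral_continuous Real.continuous_fourierChar
    (by exact continuous_inner) (integrable_indicator_one hK hb)

open ContinuousLinearMap in
/-- Plancherel's theorem for the convolution of the indicator function of `D` with a Schwartz
function. -/
lemma lintegral_enorm_sq_mul_fourierIndicator {D : Set Plane} (hD : MeasurableSet D)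
    (hb : Bornology.IsBounded D) (χ : SchwartzMap Plane ℂ) :
    ∫⁻ ξ, ‖fourierIndicator D ξ * χ ξ‖ₑ ^ 2 =
      ∫⁻ x, ‖∫ y in {y | x - y ∈ D}, (𝓕⁻ χ : SchwartzMap Plane ℂ) y‖ₑ ^ 2 := by
  have hi := integrable_indicator_one hD.nullMeasurableSet hb
  have hw := (𝓕⁻ χ : SchwartzMap Plane ℂ).integrable (μ := volume)
  set w : Plane → ℂ := ⇑(𝓕⁻ χ : SchwartzMap Plane ℂ) with hwdef
  have hfw : 𝓕 w = χ := by
    rw [hwdef, ← SchwartzMap.fourier_coe, FourierTransform.fourier_fourierInv_eq]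
  set A : Plane → ℂ := convolution (D.indicator fun _ => (1 : ℂ)) w (mul ℂ ℂ) volume with hA
  have hAx : ∀ x, A x = ∫ y in {y | x - y ∈ D}, w y := fun x => by
    have hm : MeasurableSet {y | x - y ∈ D} := (measurable_const.sub measurable_id) hD
    rw [hA, ← convolution_flip, convolution_def, ← integral_indicator hm]
    congr 1
    ext y
    by_cases hy : x - y ∈ D
    · rw [Set.indicator_of_mem (show y ∈ {y | x - y ∈ D} from hy)]; simp [hy]
    · rw [Set.indicator_of_notMem (show y ∉ {y | x - y ∈ D} from hy)]; simp [hy]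
  have hAi : Integrable A := hi.integrable_convolution (mul ℂ ℂ) hw
  have hA2 : MemLp A 2 := memLp_two_of_integrable_of_bound hAi (B := ∫ y, ‖w y‖) fun x => by
    rw [hAx]
    exact (norm_integral_le_integral_norm _).trans
      (setIntegral_le_integral hw.norm (Filter.Eventually.of_forall fun _ => norm_nonneg _))
  have h := lintegral_enorm_sq_fourier hAi hA2
  simp only [← hAx]
  rw [← h]
  refine lintegral_congr fun ξ => ?_
  rw [hA, Real.fourier_mul_convolution_eq hi hw, hfw]
  rfl

/-! ### Upper bound -/

lemma lintegral_comp_smul_plane {R : ℝ} (hR : 0 < R) (f : Plane → ℝ≥0∞) :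
    ∫⁻ x, f (R • x) = ENNReal.ofReal (R ^ 2)⁻¹ * ∫⁻ x, f x := by
  have h := (measurableEmbedding_const_smul₀ (α := Plane) hR.ne').lintegral_map
    (μ := volume) f
  rw [← h, Measure.map_addHaar_smul _ hR.ne', lintegral_smul_measure, smul_eq_mul,
    finrank_euclideanSpace, Fintype.card_fin, abs_of_pos (by positivity)]

/-- Membership of `x` and `x + t` in an interval can differ only when `x` is within `t` to the left
of an endpoint. -/
lemma lintegral_indicator_translate_sub_le {S : Set ℝ} (hS : S.OrdConnected)
    (hb : Bornology.IsBounded S) {t : ℝ} (ht : 0 ≤ t) :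
    ∫⁻ x, ‖S.indicator (fun _ => (1 : ℂ)) (x + t) - S.indicator (fun _ => (1 : ℂ)) x‖ₑ ^ 2 ≤
      ENNReal.ofReal (2 * t) := by
  rcases S.eq_empty_or_nonempty with rfl | hne
  · simp
  have hbb := hb.bddBelow
  have hba := hb.bddAbove
  set a := sInf S with ha
  set b := sSup S with hb'
  have hmem : ∀ x, a < x → x < b → x ∈ S := fun x hax hxb => by
    obtain ⟨y, hy, hyx⟩ := exists_lt_of_csInf_lt hne hax
    obtain ⟨z, hz, hxz⟩ := exists_lt_of_lt_csSup hne hxb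
    exact hS.out hy hz ⟨hyx.le, hxz.le⟩
  have hlow : ∀ x ∈ S, a ≤ x := fun x hx => csInf_le hbb hx
  have hupp : ∀ x ∈ S, x ≤ b := fun x hx => le_csSup hba hx
  calc _ ≤ ∫⁻ x, (Set.Icc (a - t) a ∪ Set.Icc (b - t) b).indicator 1 x := by
        refine lintegral_mono fun x => ?_
        by_cases hx : x ∈ Set.Icc (a - t) a ∪ Set.Icc (b - t) b
        · rw [Set.indicator_of_mem hx, Pi.one_apply]
          by_cases h1 : x ∈ S <;> by_cases h2 : x + t ∈ S <;> simp [h1, h2]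
        · have hiff : x + t ∈ S ↔ x ∈ S := by
            simp only [Set.mem_union, Set.mem_Icc, not_or, not_and_or, not_le] at hx
            obtain ⟨h1, h2⟩ := hx
            constructor
            · intro h
              have := hlow _ h
              have := hupp _ h
              have h3 : a < x := by rcases h1 with h1 | h1 <;> linarith
              have h4 : x < b := by rcases h2 with h2 | h2 <;> linarith
              exact hmem _ h3 h4
            · intro h
              have := hlow _ h
              have := hupp _ h
              have h3 : a < x + t := by rcases h1 with h1 | h1 <;> linarith
              have h4 : x + t < b := by rcases h2 with h2 | h2 <;> linarith
              exact hmem _ h3 h4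
          by_cases h1 : x ∈ S
          · simp [h1, hiff.2 h1]
          · simp [h1, mt hiff.1 h1]
    _ = volume (Set.Icc (a - t) a ∪ Set.Icc (b - t) b) :=
        lintegral_indicator_one (measurableSet_Icc.union measurableSet_Icc)
    _ ≤ volume (Set.Icc (a - t) a) + volume (Set.Icc (b - t) b) := measure_union_le _ _
    _ = ENNReal.ofReal (2 * t) := by
        rw [Real.volume_Icc, Real.volume_Icc, ← ENNReal.ofReal_add (by linarith) (by linarith)]
        congr 1; ring

section Translate

variable {K : Set Plane} {B : ℝ}

lemma abs_apply_le_norm (x : Plane) (i : Fin 2) : |x i| ≤ ‖x‖ := by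
  simpa using PiLp.norm_apply_le x i

lemma lintegral_Icc_const (B : ℝ) (c : ℝ≥0∞) :
    ∫⁻ y : ℝ, (Set.Icc (-B) B).indicator (fun _ => c) y = c * ENNReal.ofReal (2 * B) := by
  rw [lintegral_indicator measurableSet_Icc, setLIntegral_const, Real.volume_Icc]
  congr 2; ring

/-- Fubini along the direction of translation: each line meets `K` in an interval and contributes at
most `2 * t`, and only lines at transverse coordinate in `[-B, B]` meet `K`. -/
lemma lintegral_translate_sub_le (hK : Convex ℝ K) (hKm : MeasurableSet K)
    (hB : ∀ x ∈ K, ‖x‖ ≤ B) {t : ℝ} (ht : 0 ≤ t) (i : Fin 2) :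
    ∫⁻ x, ‖K.indicator (fun _ => (1 : ℂ)) (x + t • EuclideanSpace.single i 1) -
        K.indicator (fun _ => (1 : ℂ)) x‖ₑ ^ 2 ≤
      ENNReal.ofReal (2 * t) * ENNReal.ofReal (2 * B) := by
  have hind : Measurable (K.indicator fun _ => (1 : ℂ)) := measurable_const.indicator hKm
  rw [lintegral_plane, Measure.volume_eq_prod]
  have hmeas : Measurable fun p : ℝ × ℝ =>
      ‖K.indicator (fun _ => (1 : ℂ)) (!₂[p.1, p.2] + t • EuclideanSpace.single i 1) -
        K.indicator (fun _ => (1 : ℂ)) !₂[p.1, p.2]‖ₑ ^ 2 := by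
    have h1 : Measurable fun p : ℝ × ℝ => (!₂[p.1, p.2] : Plane) := planeEquiv.measurable
    exact (((hind.comp (h1.add_const _)).sub (hind.comp h1)).enorm).pow_const 2
  have hline : ∀ (v e : Plane), (∀ s : ℝ, v + s • e ∈ K → |s| ≤ B) →
      ∫⁻ s : ℝ, ‖K.indicator (fun _ => (1 : ℂ)) (v + (s + t) • e) -
        K.indicator (fun _ => (1 : ℂ)) (v + s • e)‖ₑ ^ 2 ≤ ENNReal.ofReal (2 * t) := by
    intro v e hve
    have hS : ({s : ℝ | v + s • e ∈ K}).OrdConnected := by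
      refine Convex.ordConnected ?_
      intro s hs s' hs' a b ha hb hab
      have := hK hs hs' ha hb hab
      simp only [Set.mem_ofPred_eq] at this ⊢
      convert this using 1
      rw [smul_add, smul_add, smul_smul, smul_smul, add_add_add_comm, ← add_smul, hab, one_smul,
        ← add_smul]
      rfl
    have hbd : Bornology.IsBounded {s : ℝ | v + s • e ∈ K} :=
      (Metric.isBounded_Icc (-B) B).subset fun s hs => abs_le.1 (hve s hs)
    exact lintegral_indicator_translate_sub_le hS hbd ht
  have hzero : ∀ (v e : Plane), (∀ s : ℝ, v + s • e ∉ K) →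
      ∫⁻ s : ℝ, ‖K.indicator (fun _ => (1 : ℂ)) (v + (s + t) • e) -
        K.indicator (fun _ => (1 : ℂ)) (v + s • e)‖ₑ ^ 2 = 0 := by
    intro v e hve
    simp [hve]
  have key : ∀ (y : ℝ) (v e : Plane), (∀ s : ℝ, v + s • e ∈ K → |s| ≤ B ∧ |y| ≤ B) →
      ∫⁻ s : ℝ, ‖K.indicator (fun _ => (1 : ℂ)) (v + (s + t) • e) -
        K.indicator (fun _ => (1 : ℂ)) (v + s • e)‖ₑ ^ 2 ≤
        (Set.Icc (-B) B).indicator (fun _ => ENNReal.ofReal (2 * t)) y := by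
    intro y v e h
    by_cases hy : y ∈ Set.Icc (-B) B
    · rw [Set.indicator_of_mem hy]
      exact hline v e fun s hs => (h s hs).1
    · rw [hzero v e fun s hs => hy (abs_le.1 (h s hs).2)]
      exact zero_le
  fin_cases i
  · rw [lintegral_prod_symm _ hmeas.aemeasurable, ← lintegral_Icc_const]
    refine lintegral_mono fun y => ?_
    refine le_trans (le_of_eq ?_) (key y !₂[0, y] !₂[1, 0] fun s hs => ?_)
    · refine lintegral_congr fun x => ?_
      congr 4 <;> apply plane_ext <;> simp
    · have h0 := (abs_apply_le_norm _ 0).trans (hB _ hs)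
      have h1 := (abs_apply_le_norm _ 1).trans (hB _ hs)
      simpa using And.intro h0 h1
  · rw [lintegral_prod _ hmeas.aemeasurable, ← lintegral_Icc_const]
    refine lintegral_mono fun y => ?_
    refine le_trans (le_of_eq ?_) (key y !₂[y, 0] !₂[0, 1] fun s hs => ?_)
    · refine lintegral_congr fun x => ?_
      congr 4 <;> apply plane_ext <;> simp
    · have h0 := (abs_apply_le_norm _ 0).trans (hB _ hs)
      have h1 := (abs_apply_le_norm _ 1).trans (hB _ hs)
      simpa using And.intro h1 h0

/-- Here $|e^{i\pi s}-1|=2|\sin(\pi s/2)|$, and Jordan's inequality applies because $|\pi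
s/2|\le\pi/2$. -/
lemma two_mul_abs_le_norm_fourierChar_sub_one {s : ℝ} (hs : |s| ≤ 1) :
    2 * |s| ≤ ‖(Real.fourierChar (s / 2) : ℂ) - 1‖ := by
  have h := Real.mul_abs_le_abs_sin (x := π * s / 2) (by
    rw [abs_div, abs_mul, abs_of_pos Real.pi_pos, abs_two]
    nlinarith [Real.pi_pos])
  have h2 : ‖(Real.fourierChar (s / 2) : ℂ) - 1‖ = ‖2 * Real.sin (π * s / 2)‖ := by
    rw [← Complex.norm_exp_I_mul_ofReal_sub_one, Real.fourierChar_apply]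
    congr 3
    push_cast; ring
  rw [h2, norm_mul, Real.norm_eq_abs, Real.norm_eq_abs, abs_two]
  rw [abs_div, abs_mul, abs_of_pos Real.pi_pos, abs_two] at h
  have h3 : 2 / π * (π * |s| / 2) = |s| := by field_simp
  linarith

lemma lintegral_coord_mul_fourierIndicator_le (hK : Convex ℝ K) (hKm : MeasurableSet K)
    (hB : ∀ x ∈ K, ‖x‖ ≤ B) {ρ : ℝ} (hρ : 0 < ρ) (i : Fin 2) :
    ∫⁻ ξ in Metric.closedBall 0 1, ‖(ξ i : ℂ) * fourierIndicator K (ρ • ξ)‖ₑ ^ 2 ≤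
      ENNReal.ofReal (ρ ^ 2)⁻¹ *
        (ENNReal.ofReal (2 * (2 * ρ)⁻¹) * ENNReal.ofReal (2 * B)) := by
  have hb : Bornology.IsBounded K := isBounded_iff_forall_norm_le.2 ⟨B, hB⟩
  set f : Plane → ℂ := K.indicator fun _ => (1 : ℂ) with hf
  -- This step length makes $\mathbf h\cdot\rho\boldsymbol\xi=\xi_i/2$, so that on the unit ball the
  -- multiplier stays in the range of Jordan's inequality.
  set h : Plane := (2 * ρ)⁻¹ • EuclideanSpace.single i 1 with hh
  have hfi : Integrable f := integrable_indicator_one hKm.nullMeasurableSet hb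
  have hfh : Integrable (f ∘ fun x => x + h) := hfi.comp_add_right h
  set g : Plane → ℂ := (f ∘ fun x => x + h) - f with hg
  have hgi : Integrable g := hfh.sub hfi
  have hf1 : ∀ x, ‖f x‖ ≤ 1 := fun x => by
    by_cases hx : x ∈ K <;> simp [hf, hx]
  have hg2 : MemLp g 2 := memLp_two_of_integrable_of_bound hgi (B := 2) fun x =>
    (norm_sub_le _ _).trans ((add_le_add (hf1 (x + h)) (hf1 x)).trans (by norm_num))
  have hgf : ∀ ξ, 𝓕 g ξ = ((Real.fourierChar (inner ℝ h ξ) : ℂ) - 1) * fourierIndicator K ξ := by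
    intro ξ
    have h1 : 𝓕 (f ∘ fun x => x + h) ξ = Real.fourierChar (inner ℝ h ξ) • 𝓕 f ξ :=
      congrFun (VectorFourier.fourierIntegral_comp_add_right Real.fourierChar volume
        (innerₗ Plane) f h) ξ
    have h2 : 𝓕 g ξ = 𝓕 (f ∘ fun x => x + h) ξ - 𝓕 f ξ := by
      simp only [Real.fourier_eq]
      rw [← integral_sub ((Real.fourierIntegral_convergent_iff ξ).2 hfh)
        ((Real.fourierIntegral_convergent_iff ξ).2 hfi)]
      congr 1
      ext x
      rw [hg, Pi.sub_apply, smul_sub]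
    rw [h2, h1, sub_mul, one_mul, Circle.smul_def, smul_eq_mul]
    rfl
  have hinner : ∀ ξ : Plane, inner ℝ h (ρ • ξ) = ξ i / 2 := fun ξ => by
    rw [hh, real_inner_smul_left, real_inner_smul_right, EuclideanSpace.inner_single_left]
    simp
    field_simp
  calc _ ≤ ∫⁻ ξ, ‖𝓕 g (ρ • ξ)‖ₑ ^ 2 := by
        refine (setLIntegral_mono' measurableSet_closedBall fun ξ hξ => ?_).trans
          (setLIntegral_le_lintegral _ _)
        rw [mem_closedBall_zero_iff] at hξ
        gcongr ?_ ^ 2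
        rw [enorm_le_iff_norm_le, hgf, hinner, norm_mul, norm_mul, Complex.norm_real,
          Real.norm_eq_abs]
        have h1 := two_mul_abs_le_norm_fourierChar_sub_one ((abs_apply_le_norm ξ i).trans hξ)
        exact mul_le_mul_of_nonneg_right (by linarith [abs_nonneg (ξ i)]) (norm_nonneg _)
    _ = ENNReal.ofReal (ρ ^ 2)⁻¹ * ∫⁻ x, ‖g x‖ₑ ^ 2 := by
        rw [lintegral_comp_smul_plane hρ fun ξ => ‖𝓕 g ξ‖ₑ ^ 2,
          lintegral_enorm_sq_fourier hgi hg2]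
    _ ≤ _ := by
        gcongr
        exact lintegral_translate_sub_le hK hKm hB (by positivity) i

theorem lintegral_norm_mul_fourierIndicator_le (hK : Convex ℝ K) (hKm : MeasurableSet K)
    (hB : ∀ x ∈ K, ‖x‖ ≤ B) (hB0 : 0 ≤ B) {ρ : ℝ} (hρ : 0 < ρ) :
    ∫⁻ ξ in Metric.closedBall 0 1, ENNReal.ofReal (‖ξ‖ ^ 2 * ‖fourierIndicator K (ρ • ξ)‖ ^ 2) ≤
      ENNReal.ofReal (4 * B * ρ ^ (-3 : ℤ)) := by
  have hcont := continuous_fourierIndicator hKm.nullMeasurableSet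
    (isBounded_iff_forall_norm_le.2 ⟨B, hB⟩)
  have hsum : ∀ ξ : Plane, ENNReal.ofReal (‖ξ‖ ^ 2 * ‖fourierIndicator K (ρ • ξ)‖ ^ 2) =
      ‖(ξ 0 : ℂ) * fourierIndicator K (ρ • ξ)‖ₑ ^ 2 +
        ‖(ξ 1 : ℂ) * fourierIndicator K (ρ • ξ)‖ₑ ^ 2 := fun ξ => by
    rw [← ofReal_norm, ← ofReal_norm, ← ENNReal.ofReal_pow (norm_nonneg _),
      ← ENNReal.ofReal_pow (norm_nonneg _), ← ENNReal.ofReal_add (by positivity) (by positivity),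
      norm_sq_plane, norm_mul, norm_mul, Complex.norm_real, Complex.norm_real, mul_pow, mul_pow,
      Real.norm_eq_abs, Real.norm_eq_abs, sq_abs, sq_abs, add_mul]
  simp only [hsum]
  rw [lintegral_add_left (by fun_prop)]
  refine (add_le_add (lintegral_coord_mul_fourierIndicator_le hK hKm hB hρ 0)
    (lintegral_coord_mul_fourierIndicator_le hK hKm hB hρ 1)).trans (le_of_eq ?_)
  rw [← ENNReal.ofReal_mul (by positivity), ← ENNReal.ofReal_mul (by positivity),
    ← ENNReal.ofReal_add (by positivity) (by positivity)]
  congr 1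
  rw [zpow_neg]
  field_simp
  ring

end Translate

/-! ### Nearly flat pieces of the boundary -/

/-- The lower boundary of `K` contains the graph of `f` over `[a, b]`, and at the scale `r` around
each of its points `K` is squeezed between two half planes, up to the slope `s`. -/
def HasFlatGraph (K : Set (ℝ × ℝ)) (s a b r : ℝ) (f : ℝ → ℝ) : Prop :=
  ∀ x ∈ Set.Icc a b, ∀ x' y', |x' - x| ≤ r → |y' - f x| ≤ r →
    (f x + s * |x' - x| ≤ y' → (x', y') ∈ K) ∧ (y' < f x - s * |x' - x| → (x', y') ∉ K)

/-- Mixing points of the chord with `q` in a fixed proportion `t` lifts the chord by a fixed height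
`κ`. The mixing also displaces abscissae, hence the loss of a quarter of the chord at each end. -/
lemma exists_thick_strip {K : Set (ℝ × ℝ)} (hK : Convex ℝ K) {c : ℝ → ℝ} {α β σ : ℝ}
    (hαβ : α < β) (hc : ∀ x y, c y = c x + σ * (y - x))
    (hmem : ∀ x ∈ Set.Icc α β, (x, c x) ∈ K) {q : ℝ × ℝ} (hq : q ∈ K) (hqc : c q.1 < q.2) :
    ∃ κ > 0, ∀ x ∈ Set.Icc (α + (β - α) / 4) (β - (β - α) / 4), (x, c x + κ) ∈ K := by
  set D := β - α with hD
  have hD0 : 0 < D := by linarith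
  set M := |q.1| + |α| + |β| + 1 with hM
  have hM0 : 0 < M := by positivity
  -- Chosen so that `t * M = (1 - t) * (D / 4)`: the chord point `z` to be mixed with `q` then stays
  -- within `D / 4` of `x`.
  set t := D / (4 * M + D) with ht
  have ht0 : 0 < t := by positivity
  have ht1 : t * (4 * M + D) = D := by rw [ht]; field_simp
  have ht2 : t < 1 := by
    rw [ht, div_lt_one (by positivity)]; linarith
  refine ⟨t * (q.2 - c q.1), mul_pos ht0 (by linarith), fun x hx => ?_⟩
  have hxq : |x - q.1| ≤ M := by
    have h1 : |x| ≤ |α| + |β| := by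
      rw [abs_le]
      constructor
      · linarith [neg_abs_le α, abs_nonneg β, hx.1]
      · linarith [le_abs_self β, abs_nonneg α, hx.2]
    linarith [abs_sub x q.1]
  rw [abs_le] at hxq
  set z := (x - t * q.1) / (1 - t) with hz
  have h1t : 0 < 1 - t := by linarith
  have hzx : (1 - t) * z = x - t * q.1 := by rw [hz]; field_simp
  have hz1 : (1 - t) * (z - x) = t * (x - q.1) := by linear_combination hzx
  have hzm : z ∈ Set.Icc α β := by
    have h4 : t * M = (1 - t) * (D / 4) := by linarith
    constructor
    · have : -(D / 4) ≤ z - x := by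
        by_contra hlt
        push Not at hlt
        nlinarith [mul_lt_mul_of_pos_left hlt h1t]
      linarith [hx.1]
    · have : z - x ≤ D / 4 := by
        by_contra hlt
        push Not at hlt
        nlinarith [mul_lt_mul_of_pos_left hlt h1t]
      linarith [hx.2]
  have hcomb := hK (hmem z hzm) hq h1t.le ht0.le (by ring)
  convert hcomb using 1
  ext
  · simp only [Prod.fst_add, Prod.smul_fst, smul_eq_mul]
    linarith
  · simp only [Prod.snd_add, Prod.smul_snd, smul_eq_mul]
    rw [hc x z, hc x q.1]
    linear_combination (-σ) * hzx

/-- The lower boundary between `l` and `r` is a convex function, so its slopes lie between those of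
the supporting lines at `l` and `r` and it is `s`-Lipschitz. The point `q` above the chord ensures
that `K` has thickness over the middle of the arc. -/
theorem exists_flat_graph {K : Set (ℝ × ℝ)} (hK : Convex ℝ K) (hKc : IsCompact K) {s : ℝ}
    {l r q : ℝ × ℝ} (hl : l ∈ K) (hr : r ∈ K) (hq : q ∈ K) (hlr : l.1 < r.1) {m n : ℝ}
    (hm : |m| ≤ s) (hn : |n| ≤ s) (hlm : ∀ p ∈ K, l.2 + m * (p.1 - l.1) ≤ p.2)
    (hrn : ∀ p ∈ K, r.2 + n * (p.1 - r.1) ≤ p.2)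
    (hqc : (r.2 - l.2) * (q.1 - l.1) < (q.2 - l.2) * (r.1 - l.1)) :
    ∃ (a b δ : ℝ) (f : ℝ → ℝ), a < b ∧ 0 < δ ∧ HasFlatGraph K s a b δ f := by
  have hs : 0 ≤ s := (abs_nonneg _).trans hm
  rw [abs_le] at hm hn
  set D := r.1 - l.1 with hD
  have hD0 : 0 < D := by linarith
  set σ := (r.2 - l.2) / D with hσ
  have hσD : σ * D = r.2 - l.2 := by rw [hσ]; field_simp
  have hσs : |σ| ≤ s := by
    have h1 := hlm r hr
    have h2 := hrn l hl
    rw [abs_le]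
    constructor
    · by_contra h
      push Not at h
      nlinarith
    · by_contra h
      push Not at h
      nlinarith
  have hσs' := abs_le.1 hσs
  set c : ℝ → ℝ := fun x => l.2 + σ * (x - l.1) with hcdef
  have hc : ∀ x y, c y = c x + σ * (y - x) := fun x y => by simp only [hcdef]; ring
  have hcmem : ∀ x ∈ Set.Icc l.1 r.1, (x, c x) ∈ K := fun x hx => by
    have hcomb := hK hl hr (a := (r.1 - x) / D) (b := (x - l.1) / D)
      (div_nonneg (by linarith [hx.2]) hD0.le) (div_nonneg (by linarith [hx.1]) hD0.le)
      (by field_simp; ring)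
    convert hcomb using 1
    ext
    · simp only [Prod.fst_add, Prod.smul_fst, smul_eq_mul]
      field_simp
      ring
    · simp only [Prod.snd_add, Prod.smul_snd, smul_eq_mul, hcdef, hσ]
      field_simp
      ring
  obtain ⟨κ, hκ, hthick⟩ := exists_thick_strip hK hlr hc hcmem hq (by
    have h1 : σ * (q.1 - l.1) * D < (q.2 - l.2) * D := by
      calc σ * (q.1 - l.1) * D = (σ * D) * (q.1 - l.1) := by ring
        _ < _ := by rw [hσD]; exact hqc
    have := lt_of_mul_lt_mul_right h1 hD0.le
    simp only [hcdef]; linarith)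
  set f : ℝ → ℝ := fun x => sInf {y | (x, y) ∈ K} with hf
  have hslice : ∀ x, IsCompact {y | (x, y) ∈ K} := fun x =>
    (hKc.image continuous_snd).of_isClosed_subset
      (hKc.isClosed.preimage (Continuous.prodMk_right x)) fun _ hy => ⟨_, hy, rfl⟩
  have hfmem : ∀ x y, (x, y) ∈ K → (x, f x) ∈ K := fun x y hy =>
    (hslice x).sInf_mem ⟨y, hy⟩
  have hfle : ∀ x y, (x, y) ∈ K → f x ≤ y := fun x y hy =>
    csInf_le (hslice x).bddBelow hy
  have hfl : f l.1 = l.2 := le_antisymm (hfle _ _ hl) (by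
    simpa using hlm _ (hfmem _ _ hl))
  have hfr : f r.1 = r.2 := le_antisymm (hfle _ _ hr) (by
    simpa using hrn _ (hfmem _ _ hr))
  have hfconv : ConvexOn ℝ (Set.Icc l.1 r.1) f := by
    refine ⟨convex_Icc _ _, fun x hx y hy u v hu hv huv => ?_⟩
    refine hfle _ _ ?_
    have := hK (hfmem _ _ (hcmem x hx)) (hfmem _ _ (hcmem y hy)) hu hv huv
    simpa using this
  have hlip : ∀ x ∈ Set.Ioo l.1 r.1, ∀ y ∈ Set.Ioo l.1 r.1, x < y →
      |f y - f x| ≤ s * (y - x) := by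
    intro x hx y hy hxy
    have hxI := Set.Ioo_subset_Icc_self hx
    have hyI := Set.Ioo_subset_Icc_self hy
    have h1 := hfconv.slope_mono_adjacent (Set.left_mem_Icc.2 hlr.le) hyI hx.1 hxy
    have h2 := hfconv.slope_mono_adjacent hxI (Set.right_mem_Icc.2 hlr.le) hxy hy.2
    rw [hfl] at h1
    rw [hfr] at h2
    have h3 : m ≤ (f x - l.2) / (x - l.1) := by
      rw [le_div_iff₀ (by linarith [hx.1])]
      have := hlm _ (hfmem _ _ (hcmem x hxI))
      simp only at this
      linarith
    have h4 : (r.2 - f y) / (r.1 - y) ≤ n := by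
      rw [div_le_iff₀ (by linarith [hy.2])]
      have := hrn _ (hfmem _ _ (hcmem y hyI))
      simp only at this
      linarith
    have h5 : -s ≤ (f y - f x) / (y - x) := by linarith
    have h6 : (f y - f x) / (y - x) ≤ s := by linarith
    rw [le_div_iff₀ (by linarith)] at h5
    rw [div_le_iff₀ (by linarith)] at h6
    rw [abs_le]
    constructor <;> linarith
  have hlip' : ∀ x ∈ Set.Ioo l.1 r.1, ∀ y ∈ Set.Ioo l.1 r.1, |f y - f x| ≤ s * |y - x| := by
    intro x hx y hy
    rcases lt_trichotomy x y with h | h | h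
    · rw [abs_of_pos (sub_pos.2 h)]; exact hlip x hx y hy h
    · simp [h]
    · rw [abs_sub_comm, abs_sub_comm y x, abs_of_pos (sub_pos.2 h)]; exact hlip y hy x hx h
  -- A move of `D / 12` from the middle third stays where the strip is thick, as `D / 3 - D / 12 = D
  -- / 4`. A radius `κ / (1 + s)` keeps `y'` below the top of the strip: it can exceed the chord at
  -- `x` by the radius, and the chord can drop by `s` times the radius.
  refine ⟨l.1 + D / 3, r.1 - D / 3, min (D / 12) (κ / (1 + s)), f, by linarith,
    by positivity, fun x hx x' y' hx' hy' => ?_⟩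
  have hxd := abs_le.1 (hx'.trans (min_le_left _ _))
  have hrad : (1 + s) * min (D / 12) (κ / (1 + s)) ≤ κ := by
    calc _ ≤ (1 + s) * (κ / (1 + s)) := by gcongr; exact min_le_right _ _
      _ = κ := by field_simp
  have hxI : x ∈ Set.Ioo l.1 r.1 := ⟨by linarith [hx.1], by linarith [hx.2]⟩
  have hx'I : x' ∈ Set.Ioo l.1 r.1 := ⟨by linarith [hx.1, hxd.1], by linarith [hx.2, hxd.2]⟩
  have hL := abs_le.1 (hlip' x hxI x' hx'I)
  constructor
  · intro h
    have hconn : ({y | (x', y) ∈ K}).OrdConnected := by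
      refine Convex.ordConnected fun y hy z hz u v hu hv huv => ?_
      have := hK hy hz hu hv huv
      simp only [Set.mem_ofPred_eq] at this ⊢
      convert this using 1
      ext
      · simp only [Prod.fst_add, Prod.smul_fst, smul_eq_mul]
        rw [← add_mul, huv, one_mul]
      · rfl
    have hx'K := hcmem x' (Set.Ioo_subset_Icc_self hx'I)
    refine hconn.out (hfmem _ _ hx'K)
      (hthick x' ⟨by linarith [hx.1, hxd.1], by linarith [hx.2, hxd.2]⟩) ⟨by linarith, ?_⟩
    have h1 := (abs_le.1 hy').2
    have h2 := hfle _ _ (hcmem x (Set.Ioo_subset_Icc_self hxI))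
    have h3 := hc x x'
    have h4 : |σ * (x' - x)| ≤ s * min (D / 12) (κ / (1 + s)) := by
      rw [abs_mul]
      exact mul_le_mul hσs hx' (abs_nonneg _) hs
    have h5 := (abs_le.1 h4).1
    linarith
  · intro h hmem
    have := hfle _ _ hmem
    linarith

/-- The set `C` in Cartesian coordinates whose second axis points in the direction `θ`. -/
def rotatedCoords (C : Set Plane) (θ : AngleCircle) : Set (ℝ × ℝ) :=
  {p | rotate (θ - ((π / 2 : ℝ) : AngleCircle)) !₂[p.1, p.2] ∈ C}

lemma inner_rotate_unitVec (θ : AngleCircle) (α : ℝ) (p : ℝ × ℝ) :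
    inner ℝ (rotate (θ - ((π / 2 : ℝ) : AngleCircle)) !₂[p.1, p.2]) (unitVec (θ + (α : AngleCircle)))
      = p.2 * Real.cos α - p.1 * Real.sin α := by
  set τ := θ - ((π / 2 : ℝ) : AngleCircle) with hτ
  have h : unitVec (θ + (α : AngleCircle)) = rotate τ (unitVec ((π / 2 + α : ℝ) : AngleCircle)) := by
    rw [rotate_unitVec, hτ]
    congr 1
    rw [AddCircle.coe_add]
    abel
  rw [h, ← rotateIso_apply, ← rotateIso_apply, LinearIsometryEquiv.inner_map_map, inner_plane]
  simp only [unitVec_apply_zero, unitVec_apply_one, angleCos_coe, angleSin_coe]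
  rw [add_comm (π / 2) α, Real.cos_add_pi_div_two, Real.sin_add_pi_div_two]
  simp
  ring

section RotatedCoords

variable {C : Set Plane} {θ : AngleCircle}

lemma continuous_rotate_coords (τ : AngleCircle) :
    Continuous fun p : ℝ × ℝ => rotate τ (!₂[p.1, p.2] : Plane) :=
  (rotateIso τ).continuous.comp continuous_planeEquiv

lemma rotate_coords_surjective (τ : AngleCircle) (x : Plane) :
    ∃ p : ℝ × ℝ, rotate τ !₂[p.1, p.2] = x := by
  refine ⟨(rotate (-τ) x 0, rotate (-τ) x 1), ?_⟩
  have h : (!₂[rotate (-τ) x 0, rotate (-τ) x 1] : Plane) = rotate (-τ) x :=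
    plane_ext rfl rfl
  rw [h, rotate_rotate, add_neg_cancel, rotate_zero]

lemma Convex.rotatedCoords (hC : Convex ℝ C) (θ : AngleCircle) :
    Convex ℝ (rotatedCoords C θ) := by
  intro p hp q hq a b ha hb hab
  have h := hC hp hq ha hb hab
  simp only [_root_.rotatedCoords, Set.mem_ofPred_eq] at h ⊢
  convert h using 1
  rw [← rotateIso_apply, ← rotateIso_apply, ← rotateIso_apply, ← map_smul, ← map_smul, ← map_add]
  congr 1
  apply plane_ext <;> simp

lemma isCompact_rotatedCoords (hC : IsCompact C) (θ : AngleCircle) :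
    IsCompact (rotatedCoords C θ) := by
  refine Metric.isCompact_of_isClosed_isBounded
    (hC.isClosed.preimage (continuous_rotate_coords _)) ?_
  obtain ⟨B, hB⟩ := isBounded_iff_forall_norm_le.1 hC.isBounded
  refine isBounded_iff_forall_norm_le.2 ⟨B, fun p hp => ?_⟩
  have h := hB _ hp
  rw [norm_rotate] at h
  have h0 := (abs_apply_le_norm _ 0).trans h
  have h1 := (abs_apply_le_norm _ 1).trans h
  exact max_le h0 h1

end RotatedCoords

-- Let `p₀` be a lowest point in direction `θ`. Since `θ` is not interior to the normals at `p₀`,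
-- arbitrarily small tilts `α` have a lowest point `p₁` strictly better than `p₀`. The boundary arc
-- joining `p₀` and `p₁` has slopes between `0` and `tan α`.
open Filter Topology in
theorem exists_hasFlatGraph_of_notMem_angularTrace {C : Set Plane} (hC : IsPlanarConvexBody C)
    {θ : AngleCircle} (hθ : θ ∉ angularTrace C) {s : ℝ} (hs : 0 < s) :
    ∃ (a b δ : ℝ) (f : ℝ → ℝ), a < b ∧ 0 < δ ∧
      HasFlatGraph (rotatedCoords (closure C) θ) s a b δ f := by
  set K := rotatedCoords (closure C) θ with hK
  set τ := θ - ((π / 2 : ℝ) : AngleCircle) with hτ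
  have hKconv : Convex ℝ K := hC.convex.closure.rotatedCoords θ
  have hKc : IsCompact K := isCompact_rotatedCoords hC.bounded.isCompact_closure θ
  obtain ⟨z, hz⟩ := hC.nonempty_interior
  have hKne : K.Nonempty := by
    obtain ⟨p, hp⟩ := rotate_coords_surjective τ z
    exact ⟨p, by rw [hK]; simpa [rotatedCoords, ← hτ, hp] using subset_closure (interior_subset hz)⟩
  obtain ⟨p₀, hp₀, hmin₀⟩ := hKc.exists_isMinOn hKne continuous_snd.continuousOn
  have hmin₀' : ∀ p ∈ K, p₀.2 ≤ p.2 := fun p hp => hmin₀ hp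
  have habove : ∀ x ∈ interior C, p₀.2 < inner ℝ x (unitVec θ) := by
    intro x hx
    have hnhds := mem_interior_iff_mem_nhds.1 hx
    have hct : Continuous fun e : ℝ => x - e • unitVec θ := by fun_prop
    have hev : ∀ᶠ e in 𝓝 (0 : ℝ), x - e • unitVec θ ∈ C :=
      hct.continuousAt.eventually_mem (by simpa using hnhds)
    obtain ⟨e, he, hepos⟩ := ((hev.filter_mono nhdsWithin_le_nhds).and
      (self_mem_nhdsWithin (s := Set.Ioi (0 : ℝ)))).exists
    obtain ⟨p, hp⟩ := rotate_coords_surjective τ (x - e • unitVec θ)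
    have hpK : p ∈ K := by
      rw [hK]; simpa [rotatedCoords, ← hτ, hp] using subset_closure he
    have h1 := hmin₀' p hpK
    have h2 := inner_rotate_unitVec θ 0 p
    rw [← hτ, hp] at h2
    simp only [AddCircle.coe_zero, add_zero, Real.cos_zero, Real.sin_zero, mul_one, mul_zero,
      sub_zero, inner_sub_left, real_inner_smul_left, real_inner_self_eq_norm_sq, norm_unitVec,
      one_pow] at h2
    have hepos' : 0 < e := hepos
    linarith
  have hfront : rotate τ !₂[p₀.1, p₀.2] ∈ frontier C := by
    refine ⟨hp₀, fun hint => ?_⟩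
    have h1 := habove _ hint
    have h2 := inner_rotate_unitVec θ 0 p₀
    simp only [AddCircle.coe_zero, add_zero, Real.cos_zero, Real.sin_zero, mul_one, mul_zero,
      sub_zero, ← hτ] at h2
    linarith
  obtain ⟨q, hq⟩ := rotate_coords_surjective τ z
  have hqK : q ∈ K := by
    rw [hK]; simpa [rotatedCoords, ← hτ, hq] using subset_closure (interior_subset hz)
  have hq0 : p₀.2 < q.2 := by
    have h1 := habove z hz
    have h2 := inner_rotate_unitVec θ 0 q
    simp only [AddCircle.coe_zero, add_zero, Real.cos_zero, Real.sin_zero, mul_one, mul_zero,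
      sub_zero, ← hτ, hq] at h2
    linarith
  -- The second bound keeps the interior point `q` strictly above the chord through `p₀` and `p₁`,
  -- whose slope is at most `s'` in modulus.
  set s' := min s ((q.2 - p₀.2) / (2 * (|q.1 - p₀.1| + 1))) with hs'
  have hs'0 : 0 < s' := lt_min hs (by
    have := abs_nonneg (q.1 - p₀.1)
    have : 0 < q.2 - p₀.2 := by linarith
    positivity)
  have hs'q : s' * |q.1 - p₀.1| < q.2 - p₀.2 := by
    have h1 : s' * (2 * (|q.1 - p₀.1| + 1)) ≤ q.2 - p₀.2 := by
      rw [← le_div_iff₀ (by positivity)]; exact min_le_right _ _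
    have := abs_nonneg (q.1 - p₀.1)
    nlinarith
  have hnot : ¬ ∀ᶠ α : ℝ in 𝓝 0,
      θ + (α : AngleCircle) ∈ normalAngles C (rotate τ !₂[p₀.1, p₀.2]) := by
    intro hev
    apply hθ
    refine Set.mem_iUnion₂.2 ⟨_, hfront, ?_⟩
    rw [mem_interior_iff_mem_nhds]
    have hopen : IsOpenMap fun α : ℝ => θ + (α : AngleCircle) :=
      (isOpenMap_add_left θ).comp QuotientAddGroup.isOpenMap_coe
    have := hopen.image_mem_nhds hev
    rw [AddCircle.coe_zero, add_zero] at this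
    refine mem_of_superset this ?_
    rintro _ ⟨α, hα, rfl⟩
    exact hα
  have hsmall : ∀ᶠ α : ℝ in 𝓝 0, 0 < Real.cos α ∧ |Real.tan α| < s' := by
    refine Eventually.and ?_ ?_
    · exact Real.continuous_cos.continuousAt.eventually (lt_mem_nhds (by simp))
    · have : ContinuousAt (fun α => |Real.tan α|) 0 :=
        (Real.continuousAt_tan.2 (by simp)).abs
      exact this.eventually (gt_mem_nhds (by simpa using hs'0))
  obtain ⟨α, hα, hcos, htan⟩ := ((not_eventually.1 hnot).and_eventually hsmall).exists
  have hcont : Continuous fun p : ℝ × ℝ => p.2 * Real.cos α - p.1 * Real.sin α := by fun_prop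
  obtain ⟨p₁, hp₁, hmin₁⟩ := hKc.exists_isMinOn hKne hcont.continuousOn
  have hmin₁' : ∀ p ∈ K, p₁.2 * Real.cos α - p₁.1 * Real.sin α ≤
      p.2 * Real.cos α - p.1 * Real.sin α := fun p hp => hmin₁ hp
  have hlt : p₁.2 * Real.cos α - p₁.1 * Real.sin α < p₀.2 * Real.cos α - p₀.1 * Real.sin α := by
    by_contra hge
    push Not at hge
    apply hα
    refine ⟨⟨_, hp₀, rfl⟩, ?_⟩
    rintro _ ⟨x, hx, rfl⟩
    obtain ⟨p, rfl⟩ := rotate_coords_surjective τ x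
    simp only [hτ, inner_rotate_unitVec]
    exact hge.trans (hmin₁' p hx)
  have hsin : Real.sin α = Real.tan α * Real.cos α := (Real.tan_mul_cos hcos.ne').symm
  set n := Real.tan α with hn
  have hsupp₁ : ∀ p ∈ K, p₁.2 + n * (p.1 - p₁.1) ≤ p.2 := by
    intro p hp
    have := hmin₁' p hp
    rw [hsin] at this
    have h2 : (p₁.2 + n * (p.1 - p₁.1)) * Real.cos α ≤ p.2 * Real.cos α := by linarith
    exact le_of_mul_le_mul_right h2 hcos
  have hsupp₀ : ∀ p ∈ K, p₀.2 + 0 * (p.1 - p₀.1) ≤ p.2 := by simpa using hmin₀'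
  have hlt' : p₁.2 - n * p₁.1 < p₀.2 - n * p₀.1 := by
    rw [hsin] at hlt
    have h2 : (p₁.2 - n * p₁.1) * Real.cos α < (p₀.2 - n * p₀.1) * Real.cos α := by linarith
    exact lt_of_mul_lt_mul_right h2 hcos.le
  have h01 := hmin₀' p₁ hp₁
  have hns : |n| ≤ s := htan.le.trans (min_le_left _ _)
  have hrise : p₁.2 - p₀.2 ≤ s' * |p₁.1 - p₀.1| := by
    have h1 : n * (p₁.1 - p₀.1) ≤ |n| * |p₁.1 - p₀.1| := by
      rw [← abs_mul]; exact le_abs_self _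
    have h2 := mul_le_mul_of_nonneg_right htan.le (abs_nonneg (p₁.1 - p₀.1))
    linarith
  have hprod : |(p₁.2 - p₀.2) * (q.1 - p₀.1)| ≤ |p₁.1 - p₀.1| * (s' * |q.1 - p₀.1|) := by
    rw [abs_mul, abs_of_nonneg (by linarith : 0 ≤ p₁.2 - p₀.2)]
    calc _ ≤ (s' * |p₁.1 - p₀.1|) * |q.1 - p₀.1| := by gcongr
      _ = _ := by ring
  have hprod' := abs_le.1 hprod
  rcases lt_trichotomy p₀.1 p₁.1 with h | h | h
  · have hpos : 0 < p₁.1 - p₀.1 := by linarith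
    rw [abs_of_pos hpos] at hprod'
    refine exists_flat_graph hKconv hKc hp₀ hp₁ hqK h (by simpa using hs.le) hns hsupp₀ hsupp₁ ?_
    have := mul_lt_mul_of_pos_left hs'q hpos
    linarith [hprod'.2]
  -- With equal abscissae `p₁` would be strictly lower than `p₀`, against the minimality of `p₀`.
  · rw [h] at hlt'
    linarith
  · have hpos : 0 < p₀.1 - p₁.1 := by linarith
    rw [abs_sub_comm p₁.1, abs_of_pos hpos] at hprod'
    refine exists_flat_graph hKconv hKc hp₁ hp₀ hqK h hns (by simpa using hs.le) hsupp₁ hsupp₀ ?_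
    have := mul_lt_mul_of_pos_left hs'q hpos
    linarith [hprod'.1]

/-! ### Smoothed indicator functions near a flat piece of the boundary -/

section HalfPlane

open Filter Topology

lemma norm_setIntegral_sub_setIntegral_le {α : Type*} [MeasurableSpace α] {μ : Measure α}
    {w : α → ℂ} (hw : Integrable w μ) {S H Z : Set α} (hS : MeasurableSet S)
    (hH : MeasurableSet H) (hZ : MeasurableSet Z) (h : ∀ y ∉ Z, (y ∈ S ↔ y ∈ H)) :
    ‖∫ y in S, w y ∂μ - ∫ y in H, w y ∂μ‖ ≤ ∫ y in Z, ‖w y‖ ∂μ := by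
  rw [← integral_indicator hS, ← integral_indicator hH, ← integral_indicator hZ,
    ← integral_sub (hw.indicator hS) (hw.indicator hH)]
  refine norm_integral_le_of_norm_le (hw.norm.indicator hZ) (Eventually.of_forall fun y => ?_)
  by_cases hy : y ∈ Z
  · rw [Set.indicator_of_mem hy]
    by_cases h1 : y ∈ S <;> by_cases h2 : y ∈ H <;> simp [h1, h2]
  · by_cases h1 : y ∈ S
    · simp [h1, (h y hy).1 h1, hy]
    · simp [h1, mt (h y hy).2 h1, hy]

lemma exists_setIntegral_norm_le {α : Type*} [MeasurableSpace α] {μ : Measure α}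
    {w : α → ℂ} (hw : Integrable w μ) {Z : ℕ → Set α} (hZ : ∀ n, MeasurableSet (Z n))
    (hanti : Antitone Z) (hnull : μ (⋂ n, Z n) = 0) {ε : ℝ} (hε : 0 < ε) :
    ∃ n, ∫ y in Z n, ‖w y‖ ∂μ ≤ ε := by
  have h := tendsto_setIntegral_of_antitone (f := fun y => ‖w y‖) hZ hanti
    ⟨0, hw.norm.integrableOn⟩
  rw [setIntegral_measure_zero _ hnull] at h
  obtain ⟨n, hn⟩ := (h.eventually (gt_mem_nhds hε)).exists
  exact ⟨n, hn.le⟩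

lemma volume_horizontal_line (t : ℝ) : volume {y : ℝ × ℝ | y.2 = t} = 0 := by
  have : {y : ℝ × ℝ | y.2 = t} = Set.univ ×ˢ {t} := by ext; simp
  rw [this, Measure.volume_eq_prod, Measure.prod_prod, Real.volume_singleton, mul_zero]

/-- As `s` tends to `0` the wedges decrease to a horizontal line, which is null. -/
lemma exists_wedge_setIntegral_norm_le {w : ℝ × ℝ → ℂ} (hw : Integrable w) (t : ℝ) {ε : ℝ}
    (hε : 0 < ε) : ∃ s > 0, ∫ y in {y : ℝ × ℝ | |t - y.2| ≤ s * (|y.1| + 1)}, ‖w y‖ ≤ ε := by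
  have hmeas : ∀ s : ℝ, MeasurableSet {y : ℝ × ℝ | |t - y.2| ≤ s * (|y.1| + 1)} := fun s =>
    (isClosed_le (by fun_prop) (by fun_prop)).measurableSet
  have hnull : volume (⋂ n : ℕ,
      {y : ℝ × ℝ | |t - y.2| ≤ (1 / ((n : ℝ) + 1)) * (|y.1| + 1)}) = 0 := by
    refine measure_mono_null (fun y hy => ?_) (volume_horizontal_line t)
    rw [Set.mem_iInter] at hy
    have hlim : Tendsto (fun n : ℕ => (1 / ((n : ℝ) + 1)) * (|y.1| + 1)) atTop (𝓝 0) := by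
      simpa using (tendsto_one_div_add_atTop_nhds_zero_nat (𝕜 := ℝ)).mul_const (|y.1| + 1)
    have h0 : |t - y.2| ≤ 0 := ge_of_tendsto' hlim hy
    have := abs_eq_zero.1 (le_antisymm h0 (abs_nonneg _))
    simp only [Set.mem_ofPred_eq]
    linarith
  obtain ⟨n, hn⟩ := exists_setIntegral_norm_le hw
    (Z := fun n : ℕ => {y : ℝ × ℝ | |t - y.2| ≤ (1 / ((n : ℝ) + 1)) * (|y.1| + 1)})
    (fun n => hmeas _) (fun m n hmn y hy => by
      have h1 := Nat.one_div_le_one_div (α := ℝ) hmn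
      have h2 : |t - y.2| ≤ (1 / ((n : ℝ) + 1)) * (|y.1| + 1) := hy
      exact h2.trans (mul_le_mul_of_nonneg_right h1 (by positivity))) hnull hε
  exact ⟨_, Nat.one_div_pos_of_nat, hn⟩

lemma exists_tail_setIntegral_norm_le {w : ℝ × ℝ → ℂ} (hw : Integrable w) {ε : ℝ}
    (hε : 0 < ε) : ∃ M > 0, ∫ y in {y : ℝ × ℝ | M < ‖y‖}, ‖w y‖ ≤ ε := by
  have hnull : volume (⋂ n : ℕ, {y : ℝ × ℝ | (n : ℝ) + 1 < ‖y‖}) = 0 := by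
    refine measure_mono_null (fun y hy => ?_) measure_empty
    exfalso
    rw [Set.mem_iInter] at hy
    obtain ⟨n, hn⟩ := exists_nat_gt ‖y‖
    have : (n : ℝ) + 1 < ‖y‖ := hy n
    linarith
  obtain ⟨n, hn⟩ := exists_setIntegral_norm_le hw
    (Z := fun n : ℕ => {y : ℝ × ℝ | (n : ℝ) + 1 < ‖y‖})
    (fun n => (isOpen_lt (by fun_prop) (by fun_prop)).measurableSet)
    (fun m n hmn y hy => by
      have h1 : (m : ℝ) ≤ n := by exact_mod_cast hmn
      have h2 : (n : ℝ) + 1 < ‖y‖ := hy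
      exact lt_of_le_of_lt (by linarith) h2) hnull hε
  exact ⟨_, by positivity, hn⟩

/-- Seen from a boundary point after dilation by `R`, the set is a half plane up to a wedge of slope
`s`. The `+ 1` in the wedge absorbs the shift `|t - t₀| ≤ s`, and `hRM` keeps all points within the
scale `δ` of flatness. -/
lemma HasFlatGraph.mem_iff {K : Set (ℝ × ℝ)} {s a b δ : ℝ} {f : ℝ → ℝ}
    (hflat : HasFlatGraph K s a b δ f) {R M t t₀ x : ℝ} (hR : 0 < R)
    (hRM : M + |t₀| + s ≤ δ * R) (hx : x ∈ Set.Icc a b) (ht : |t - t₀| ≤ s) {y : ℝ × ℝ}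
    (hy : ‖y‖ ≤ M) (hyw : s * (|y.1| + 1) < |t₀ - y.2|) :
    R⁻¹ • ((R * x, R * f x + t) - y) ∈ K ↔ y.2 ≤ t₀ := by
  have hy1 : |y.1| ≤ M := (norm_fst_le y).trans hy
  have hy2 : |y.2| ≤ M := (norm_snd_le y).trans hy
  have hs : 0 ≤ s := (abs_nonneg _).trans ht
  have heq : R⁻¹ • ((R * x, R * f x + t) - y) = (x - y.1 / R, f x + (t - y.2) / R) := by
    ext
    · simp; field_simp
    · simp; field_simp; ring
  rw [heq]
  have hd1 : |x - y.1 / R - x| = |y.1| / R := by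
    rw [sub_sub_cancel_left, abs_neg, abs_div, abs_of_pos hR]
  have hd2 : |f x + (t - y.2) / R - f x| = |t - y.2| / R := by
    rw [add_sub_cancel_left, abs_div, abs_of_pos hR]
  have ht' := abs_le.1 ht
  have htt : |t - y.2| ≤ M + |t₀| + s := by
    have h1 := abs_le.1 hy2
    have h2 := neg_abs_le t₀
    have h3 := le_abs_self t₀
    rw [abs_le]
    constructor <;> linarith
  have h := hflat x hx (x - y.1 / R) (f x + (t - y.2) / R)
    (by rw [hd1, div_le_iff₀ hR]; linarith [abs_nonneg t₀])
    (by rw [hd2, div_le_iff₀ hR]; linarith)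
  rw [hd1] at h
  have hyw0 : 0 < |t₀ - y.2| := lt_of_le_of_lt (by positivity) hyw
  constructor
  · intro hmem
    by_contra hlt
    push Not at hlt
    refine h.2 ?_ hmem
    rw [abs_of_neg (a := t₀ - y.2) (by linarith)] at hyw
    have : (t - y.2) / R < - (s * (|y.1| / R)) := by
      rw [← mul_div_assoc, ← neg_div]
      gcongr
      linarith
    linarith
  · intro hle
    refine h.1 ?_
    rw [abs_of_nonneg (a := t₀ - y.2) (by linarith)] at hyw
    have : s * (|y.1| / R) ≤ (t - y.2) / R := by
      rw [← mul_div_assoc]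
      gcongr
      linarith
    linarith

lemma measurable_smoothed {K : Set (ℝ × ℝ)} (hK : MeasurableSet K) {w : ℝ × ℝ → ℂ}
    (hw : Measurable w) (R : ℝ) :
    Measurable fun x : ℝ × ℝ => ∫ y in {y | R⁻¹ • (x - y) ∈ K}, w y := by
  have hset : MeasurableSet {z : (ℝ × ℝ) × (ℝ × ℝ) | R⁻¹ • (z.1 - z.2) ∈ K} :=
    ((measurable_fst.sub measurable_snd).const_smul R⁻¹) hK
  have hjoint : Measurable ({z : (ℝ × ℝ) × (ℝ × ℝ) | R⁻¹ • (z.1 - z.2) ∈ K}.indicator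
      fun z => w z.2) := (hw.comp measurable_snd).indicator hset
  have h := hjoint.stronglyMeasurable.integral_prod_right' (ν := (volume : Measure (ℝ × ℝ)))
  convert h.measurable using 2 with x
  have hx : MeasurableSet {y : ℝ × ℝ | R⁻¹ • (x - y) ∈ K} :=
    ((measurable_const.sub measurable_id).const_smul R⁻¹) hK
  rw [← integral_indicator hx]
  rfl

/-- The slope `s` depends on `w` and `t₀` alone, so a flat piece of `K` can be selected afterwards.
The wedge and the tail each cost a quarter of `‖Φ‖`, leaving modulus at least `‖Φ‖ / 2` on a curved
strip of length `R * (b - a)` and height `2 * s`. -/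
theorem exists_lintegral_smoothed_ge {w : ℝ × ℝ → ℂ} (hw : Integrable w) (hwm : Measurable w)
    {t₀ : ℝ} (hΦ : ∫ y in {y : ℝ × ℝ | y.2 ≤ t₀}, w y ≠ 0) :
    ∃ s > 0, ∀ (K : Set (ℝ × ℝ)) (a b δ : ℝ) (f : ℝ → ℝ), MeasurableSet K → a < b → 0 < δ →
      HasFlatGraph K s a b δ f → ∃ c > 0, ∃ R₀ > 0, ∀ R ≥ R₀,
        ENNReal.ofReal (c * R) ≤
          ∫⁻ x : ℝ × ℝ, ‖∫ y in {y | R⁻¹ • (x - y) ∈ K}, w y‖ₑ ^ 2 := by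
  set Φ := ∫ y in {y : ℝ × ℝ | y.2 ≤ t₀}, w y with hΦdef
  have hΦ0 : 0 < ‖Φ‖ := norm_pos_iff.2 hΦ
  obtain ⟨s, hs, hwedge⟩ := exists_wedge_setIntegral_norm_le hw t₀ (ε := ‖Φ‖ / 4) (by positivity)
  obtain ⟨M, hM, htail⟩ := exists_tail_setIntegral_norm_le hw (ε := ‖Φ‖ / 4) (by positivity)
  refine ⟨s, hs, fun K a b δ f hK hab hδ hflat => ?_⟩
  have hba : 0 < b - a := by linarith
  refine ⟨(‖Φ‖ / 2) ^ 2 * (2 * s) * (b - a), by positivity, (M + |t₀| + s) / δ, by positivity,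
    fun R hR => ?_⟩
  have hRM : M + |t₀| + s ≤ δ * R := by
    rw [ge_iff_le, div_le_iff₀ hδ] at hR; linarith
  have hR0 : 0 < R := lt_of_lt_of_le (by positivity) hR
  have hpt : ∀ x ∈ Set.Icc a b, ∀ t, |t - t₀| ≤ s →
      ‖Φ‖ / 2 ≤ ‖∫ y in {y : ℝ × ℝ | R⁻¹ • ((R * x, R * f x + t) - y) ∈ K}, w y‖ := by
    intro x hx t ht
    have hmE : MeasurableSet {y : ℝ × ℝ | |t₀ - y.2| ≤ s * (|y.1| + 1)} :=
      (isClosed_le (by fun_prop) (by fun_prop)).measurableSet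
    have hmT : MeasurableSet {y : ℝ × ℝ | M < ‖y‖} :=
      (isOpen_lt (by fun_prop) (by fun_prop)).measurableSet
    have hmH : MeasurableSet {y : ℝ × ℝ | y.2 ≤ t₀} :=
      (isClosed_le (by fun_prop) (by fun_prop)).measurableSet
    have hmS : MeasurableSet {y : ℝ × ℝ | R⁻¹ • ((R * x, R * f x + t) - y) ∈ K} :=
      ((measurable_const.sub measurable_id).const_smul R⁻¹) hK
    have h := norm_setIntegral_sub_setIntegral_le hw hmS hmH (hmE.union hmT) fun y hy => by
      simp only [Set.mem_union, Set.mem_ofPred_eq, not_or, not_le, not_lt] at hy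
      exact hflat.mem_iff hR0 hRM hx ht hy.2 hy.1
    have hunion : ∫ y in {y : ℝ × ℝ | |t₀ - y.2| ≤ s * (|y.1| + 1)} ∪ {y : ℝ × ℝ | M < ‖y‖},
        ‖w y‖ ≤ ‖Φ‖ / 4 + ‖Φ‖ / 4 := by
      refine le_trans ?_ (add_le_add hwedge htail)
      rw [← integral_indicator (hmE.union hmT), ← integral_indicator hmE, ← integral_indicator hmT,
        ← integral_add (hw.norm.indicator hmE) (hw.norm.indicator hmT)]
      refine integral_mono (hw.norm.indicator (hmE.union hmT))
        ((hw.norm.indicator hmE).add (hw.norm.indicator hmT)) fun y => ?_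
      by_cases h1 : y ∈ {y : ℝ × ℝ | |t₀ - y.2| ≤ s * (|y.1| + 1)} <;>
        by_cases h2 : y ∈ {y : ℝ × ℝ | M < ‖y‖} <;>
        simp only [Set.indicator, Set.mem_union, h1, h2, or_true, true_or, or_self, if_true,
          if_false, add_zero, zero_add, le_refl, le_add_iff_nonneg_left, norm_nonneg]
    have h2 := norm_sub_norm_le Φ (Φ - ∫ y in {y : ℝ × ℝ | R⁻¹ • ((R * x, R * f x + t) - y) ∈ K}, w y)
    rw [sub_sub_cancel, norm_sub_rev Φ] at h2
    linarith
  have hAm := ((measurable_smoothed hK hwm R).enorm.pow_const 2).aemeasurable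
    (μ := (volume : Measure (ℝ × ℝ)))
  rw [Measure.volume_eq_prod] at hAm ⊢
  rw [lintegral_prod _ hAm]
  have hinner : ∀ x ∈ Set.Icc (R * a) (R * b),
      ENNReal.ofReal ((‖Φ‖ / 2) ^ 2) * ENNReal.ofReal (2 * s) ≤
        ∫⁻ t, ‖∫ y in {y | R⁻¹ • ((x, t) - y) ∈ K}, w y‖ₑ ^ 2 := by
    intro x hx
    have hxR : x / R ∈ Set.Icc a b :=
      ⟨by rw [le_div_iff₀ hR0]; linarith [hx.1], by rw [div_le_iff₀ hR0]; linarith [hx.2]⟩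
    have hxx : R * (x / R) = x := by field_simp
    calc _ = ∫⁻ _ in Set.Icc (R * f (x / R) + (t₀ - s)) (R * f (x / R) + (t₀ + s)),
          ENNReal.ofReal ((‖Φ‖ / 2) ^ 2) := by
          rw [setLIntegral_const, Real.volume_Icc]
          congr 2; ring
      _ ≤ ∫⁻ t in Set.Icc (R * f (x / R) + (t₀ - s)) (R * f (x / R) + (t₀ + s)),
          ‖∫ y in {y | R⁻¹ • ((x, t) - y) ∈ K}, w y‖ₑ ^ 2 := by
          refine setLIntegral_mono' measurableSet_Icc fun t ht => ?_
          have h := hpt _ hxR (t - R * f (x / R)) (by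
            rw [abs_le]; constructor <;> linarith [ht.1, ht.2])
          rw [hxx, add_sub_cancel] at h
          rw [← ofReal_norm, ← ENNReal.ofReal_pow (norm_nonneg _)]
          gcongr
      _ ≤ _ := setLIntegral_le_lintegral _ _
  calc _ = ∫⁻ _ in Set.Icc (R * a) (R * b),
        ENNReal.ofReal ((‖Φ‖ / 2) ^ 2) * ENNReal.ofReal (2 * s) := by
        rw [setLIntegral_const, Real.volume_Icc, ← ENNReal.ofReal_mul (by positivity),
          ← ENNReal.ofReal_mul (by positivity)]
        congr 1; ring
    _ ≤ ∫⁻ x in Set.Icc (R * a) (R * b),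
        ∫⁻ t, ‖∫ y in {y | R⁻¹ • ((x, t) - y) ∈ K}, w y‖ₑ ^ 2 :=
        setLIntegral_mono' measurableSet_Icc hinner
    _ ≤ _ := setLIntegral_le_lintegral _ _

lemma ae_eq_zero_of_forall_setIntegral_Iic {W : ℝ → ℂ} (hW : Integrable W)
    (h : ∀ t, ∫ x in Set.Iic t, W x = 0) : ∀ᵐ x, W x = 0 := by
  filter_upwards [LocallyIntegrable.ae_hasDerivAt_integral hW.locallyIntegrable] with x hx
  have h0 : (fun y => ∫ z in (0 : ℝ)..y, W z) = fun _ => 0 := by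
    ext y
    rw [← intervalIntegral.integral_Iic_sub_Iic hW.integrableOn hW.integrableOn, h, h, sub_zero]
  have := hx 0
  rw [h0] at this
  exact this.unique (hasDerivAt_const x 0)

/-- If every half-plane integral vanished, Lebesgue differentiation would kill the integrals of `w`
over almost all horizontal lines, and Fubini would kill the integral against `e`. -/
theorem exists_halfPlane_integral_ne_zero {w : ℝ × ℝ → ℂ} (hw : Integrable w) {e : ℝ → ℂ}
    (he : ∫ p : ℝ × ℝ, e p.2 * w p ≠ 0) (hei : Integrable fun p : ℝ × ℝ => e p.2 * w p) :
    ∃ t, ∫ p in {p : ℝ × ℝ | p.2 ≤ t}, w p ≠ 0 := by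
  by_contra hall
  push Not at hall
  apply he
  rw [Measure.volume_eq_prod] at hw hei ⊢
  rw [integral_prod_symm _ hei]
  have hW : Integrable fun t => ∫ x, w (x, t) := hw.integral_prod_right
  have hzero := ae_eq_zero_of_forall_setIntegral_Iic hW fun t => by
    rw [← hall t]
    have hset : {p : ℝ × ℝ | p.2 ≤ t} = Set.univ ×ˢ Set.Iic t := by ext; simp
    have hw' : IntegrableOn w (Set.univ ×ˢ Set.Iic t) (volume.prod volume) := hw.integrableOn
    rw [hset, Measure.volume_eq_prod, ← Measure.prod_restrict, Measure.restrict_univ]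
    rw [IntegrableOn, ← Measure.prod_restrict, Measure.restrict_univ] at hw'
    rw [integral_prod_symm _ hw']
  have : ∀ᵐ t, ∫ x, e t * w (x, t) = 0 := by
    filter_upwards [hzero] with t ht
    rw [integral_const_mul, ht, mul_zero]
  rw [integral_congr_ae this, integral_zero]

end HalfPlane

/-! ### The radial energy of the Fourier transform -/

/-- The contribution `∫_0^1 δ⁴ |F(δρ u(φ))|² dδ` of the direction `φ`, where `F` is the Fourier
transform of the indicator function of `K`. -/
noncomputable def radialEnergy (K : Set Plane) (ρ : ℝ) (φ : AngleCircle) : ℝ :=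
  ∫ δ in (0 : ℝ)..1, δ ^ 4 * ‖fourierIndicator K ((δ * ρ) • unitVec φ)‖ ^ 2

section RadialEnergy

variable {K : Set Plane}

lemma fourierAverage_eq (K : Set Plane) (I : Set AngleCircle) (ω : AngleCircle) (ρ : ℝ) :
    fourierAverage K I ω ρ = ∫ θ in I, radialEnergy K ρ (ω - θ) := by
  unfold fourierAverage radialEnergy
  congr 1
  ext θ
  refine intervalIntegral.integral_congr_ae (Filter.Eventually.of_forall fun δ hδ => ?_)
  -- The half-open interval omits `δ = 0`, so the scaling formula applies throughout.
  rw [Set.uIoc_of_le zero_le_one] at hδ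
  rw [fourierIndicator_dilateRotate hδ.1, norm_mul, norm_pow, Complex.norm_real,
    Real.norm_of_nonneg hδ.1.le]
  ring

lemma radialEnergy_nonneg (K : Set Plane) (ρ : ℝ) (φ : AngleCircle) : 0 ≤ radialEnergy K ρ φ :=
  intervalIntegral.integral_nonneg zero_le_one fun _ _ => by positivity

lemma radialEnergy_add_pi (K : Set Plane) (ρ : ℝ) (φ : AngleCircle) :
    radialEnergy K ρ (φ + ((π : ℝ) : AngleCircle)) = radialEnergy K ρ φ := by
  unfold radialEnergy
  simp only [unitVec_add_pi, smul_neg, norm_fourierIndicator_neg]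

lemma continuous_radialEnergy (hF : Continuous (fourierIndicator K)) (ρ : ℝ) :
    Continuous (radialEnergy K ρ) := by
  refine intervalIntegral.continuous_parametric_intervalIntegral_of_continuous' ?_ 0 1
  have h : Continuous fun p : AngleCircle × ℝ => (p.2 * ρ) • unitVec p.1 :=
    (continuous_snd.mul continuous_const).smul (continuous_unitVec.comp continuous_fst)
  have := (hF.comp h).norm
  simp only [Function.uncurry_def]
  exact (continuous_snd.pow 4).mul (this.pow 2)

lemma ofReal_radialEnergy (hF : Continuous (fourierIndicator K)) (ρ : ℝ) (φ : AngleCircle) :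
    ENNReal.ofReal (radialEnergy K ρ φ) = ∫⁻ δ in Set.Ioc (0 : ℝ) 1,
      ENNReal.ofReal (δ ^ 4 * ‖fourierIndicator K ((δ * ρ) • unitVec φ)‖ ^ 2) := by
  unfold radialEnergy
  rw [intervalIntegral.integral_of_le zero_le_one, ofReal_integral_eq_lintegral_ofReal]
  · refine (Continuous.integrableOn_Icc ?_).mono_set Set.Ioc_subset_Icc_self
    fun_prop
  · exact Filter.Eventually.of_forall fun δ => by positivity

theorem lintegral_radialEnergy_le (hK : Convex ℝ K) (hKm : MeasurableSet K) {B : ℝ}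
    (hB : ∀ x ∈ K, ‖x‖ ≤ B) (hB0 : 0 ≤ B) {ρ : ℝ} (hρ : 0 < ρ) :
    ∫⁻ φ, ENNReal.ofReal (radialEnergy K ρ φ) ≤ ENNReal.ofReal (4 * B * ρ ^ (-3 : ℤ)) := by
  have hF := continuous_fourierIndicator hKm.nullMeasurableSet
    (isBounded_iff_forall_norm_le.2 ⟨B, hB⟩)
  refine le_trans ?_ (lintegral_norm_mul_fourierIndicator_le hK hKm hB hB0 hρ)
  rw [← lintegral_indicator Metric.isClosed_closedBall.measurableSet, lintegral_plane_polar]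
  swap
  · refine Measurable.indicator ?_ Metric.isClosed_closedBall.measurableSet
    fun_prop
  refine lintegral_mono fun φ => ?_
  rw [ofReal_radialEnergy hF]
  refine (setLIntegral_mono' measurableSet_Ioc fun r hr => ?_).trans
    (lintegral_mono_set Set.Ioc_subset_Ioi_self)
  have hnorm : ‖r • unitVec φ‖ = r := by
    rw [norm_smul, norm_unitVec, mul_one, Real.norm_of_nonneg hr.1.le]
  rw [Set.indicator_of_mem (by rw [mem_closedBall_zero_iff, hnorm]; exact hr.2), hnorm, smul_smul,
    mul_comm ρ r, ← ENNReal.ofReal_mul hr.1.le, ← mul_assoc]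
  refine ENNReal.ofReal_le_ofReal (mul_le_mul_of_nonneg_right ?_ (by positivity))
  -- The factor `r` is the polar Jacobian and `r ^ 2` is `‖ξ‖ ^ 2`.
  calc r ^ 4 = r * r ^ 2 * r := by ring
    _ ≤ r * r ^ 2 * 1 := by have := hr.1; gcongr; exact hr.2
    _ = _ := mul_one _

/-- By uniqueness of polar coordinates, `unitVec θ / 2` avoids the compact set of vectors of length
at most `1` with angle off the arc. -/
lemma exists_ball_subset_sector (θ : AngleCircle) {η : ℝ} (hη : 0 < η) :
    ∃ ε > 0, ∀ r : ℝ, 0 < r → ∀ φ : AngleCircle,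
      r • unitVec φ ∈ Metric.ball ((1 / 2 : ℝ) • unitVec θ) ε →
        φ ∈ Metric.ball θ η ∧ 1 / 4 ≤ r ∧ r ≤ 1 := by
  set S : Set Plane := (fun p : ℝ × AngleCircle => p.1 • unitVec p.2) ''
    (Set.Icc 0 1 ×ˢ (Metric.ball θ η)ᶜ) with hS
  have hScomp : IsCompact S :=
    (isCompact_Icc.prod Metric.isOpen_ball.isClosed_compl.isCompact).image
      (continuous_fst.smul (continuous_unitVec.comp continuous_snd))
  have hnot : (1 / 2 : ℝ) • unitVec θ ∉ S := by
    rintro ⟨⟨r, φ⟩, ⟨hr, hφ⟩, h⟩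
    simp only at h
    have hn := congrArg norm h
    rw [norm_smul, norm_smul, norm_unitVec, norm_unitVec, Real.norm_of_nonneg hr.1] at hn
    have hr2 : r = 1 / 2 := by simpa using hn
    rw [hr2] at h
    have := unitVec_injective (smul_right_injective Plane (by norm_num : (1 / 2 : ℝ) ≠ 0) h)
    exact hφ (by simpa [this] using hη)
  obtain ⟨ε, hε, hball⟩ := Metric.isOpen_iff.1 hScomp.isClosed.isOpen_compl _ hnot
  refine ⟨min ε (1 / 4), lt_min hε (by norm_num), fun r hr φ hmem => ?_⟩
  have hdist := Metric.mem_ball.1 hmem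
  rw [dist_eq_norm] at hdist
  have hn := (abs_norm_sub_norm_le _ _).trans_lt (hdist.trans_le (min_le_right _ _))
  rw [norm_smul, norm_smul, norm_unitVec, norm_unitVec, Real.norm_of_nonneg hr.le,
    Real.norm_of_nonneg (by norm_num), mul_one, mul_one, abs_lt] at hn
  have h1 : 1 / 4 ≤ r := by linarith
  have h2 : r ≤ 1 := by linarith
  refine ⟨?_, h1, h2⟩
  by_contra hφ
  exact hball (Metric.ball_subset_ball (min_le_left _ _) hmem) ⟨(r, φ), ⟨⟨hr.le, h2⟩, hφ⟩, rfl⟩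

/-- On the support of `χ` one has `r ≥ 1 / 4`, so the Jacobian `r` is at most `64 * r ^ 4`, the
weight in `radialEnergy`. -/
lemma lintegral_mul_bump_le (hF : Continuous (fourierIndicator K)) {θ : AngleCircle} {η ε : ℝ}
    (hsector : ∀ r : ℝ, 0 < r → ∀ φ : AngleCircle,
      r • unitVec φ ∈ Metric.ball ((1 / 2 : ℝ) • unitVec θ) ε →
        φ ∈ Metric.ball θ η ∧ 1 / 4 ≤ r ∧ r ≤ 1)
    {χ : Plane → ℂ} (hχ : Continuous χ) (hχ1 : ∀ ξ, ‖χ ξ‖ ≤ 1)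
    (hsupp : ∀ ξ ∉ Metric.ball ((1 / 2 : ℝ) • unitVec θ) ε, χ ξ = 0) (R : ℝ) :
    ∫⁻ ξ, ‖fourierIndicator K (R • ξ) * χ ξ‖ₑ ^ 2 ≤
      64 * ∫⁻ φ in Metric.ball θ η, ENNReal.ofReal (radialEnergy K R φ) := by
  rw [lintegral_plane_polar (by fun_prop), ← lintegral_const_mul' 64 _ (by norm_num),
    ← lintegral_indicator Metric.isOpen_ball.measurableSet]
  refine lintegral_mono fun φ => ?_
  by_cases hφ : φ ∈ Metric.ball θ η
  · rw [Set.indicator_of_mem hφ, ofReal_radialEnergy hF,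
      ← lintegral_const_mul' _ _ (by norm_num), ← lintegral_indicator measurableSet_Ioc,
      ← lintegral_indicator measurableSet_Ioi]
    refine lintegral_mono fun r => ?_
    by_cases hr : r ∈ Set.Ioi (0 : ℝ)
    swap
    · rw [Set.indicator_of_notMem hr]; exact zero_le
    have hr0 : 0 < r := hr
    rw [Set.indicator_of_mem hr]
    by_cases hm : r • unitVec φ ∈ Metric.ball ((1 / 2 : ℝ) • unitVec θ) ε
    · obtain ⟨-, h1, h2⟩ := hsector r hr φ hm
      rw [Set.indicator_of_mem (show r ∈ Set.Ioc (0 : ℝ) 1 from ⟨hr, h2⟩), smul_smul, mul_comm R r,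
        ← ofReal_norm, ← ENNReal.ofReal_pow (norm_nonneg _), ← ENNReal.ofReal_mul hr0.le,
        (ENNReal.ofReal_ofNat 64).symm, ← ENNReal.ofReal_mul (by norm_num)]
      refine ENNReal.ofReal_le_ofReal ?_
      have h3 : ‖fourierIndicator K ((r * R) • unitVec φ) * χ (r • unitVec φ)‖ ≤
          ‖fourierIndicator K ((r * R) • unitVec φ)‖ := by
        rw [norm_mul]
        exact mul_le_of_le_one_right (norm_nonneg _) (hχ1 _)
      have h4 : 1 ≤ 64 * r ^ 3 := by
        have : (1 / 4 : ℝ) ^ 3 ≤ r ^ 3 := by gcongr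
        linarith
      calc _ ≤ r * ‖fourierIndicator K ((r * R) • unitVec φ)‖ ^ 2 * 1 := by
            rw [mul_one]; gcongr
        _ ≤ r * ‖fourierIndicator K ((r * R) • unitVec φ)‖ ^ 2 * (64 * r ^ 3) := by gcongr
        _ = _ := by ring
    · rw [hsupp _ hm]; simp
  · rw [Set.indicator_of_notMem hφ, setLIntegral_congr_fun measurableSet_Ioi (g := fun _ => 0)]
    · simp
    · intro r hr
      have : χ (r • unitVec φ) = 0 := hsupp _ fun hm => hφ (hsector r hr φ hm).1
      simp [this]

/-- The measurable equivalence behind `rotatedCoords`. -/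
noncomputable def rotatedPlaneEquiv (θ : AngleCircle) : ℝ × ℝ ≃ᵐ Plane :=
  planeEquiv.trans (rotateIso (θ - ((π / 2 : ℝ) : AngleCircle))).toMeasurableEquiv

lemma rotatedPlaneEquiv_apply (θ : AngleCircle) (p : ℝ × ℝ) :
    rotatedPlaneEquiv θ p = rotate (θ - ((π / 2 : ℝ) : AngleCircle)) !₂[p.1, p.2] := rfl

lemma measurePreserving_rotatedPlaneEquiv (θ : AngleCircle) :
    MeasurePreserving (rotatedPlaneEquiv θ) :=
  (rotateIso (θ - ((π / 2 : ℝ) : AngleCircle))).measurePreserving.comp measurePreserving_planeEquiv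

lemma continuous_rotatedPlaneEquiv (θ : AngleCircle) : Continuous (rotatedPlaneEquiv θ) :=
  continuous_rotate_coords _

lemma rotatedPlaneEquiv_sub_mem_iff (θ : AngleCircle) {R : ℝ} (hR : 0 < R) (p q : ℝ × ℝ) :
    rotatedPlaneEquiv θ p - rotatedPlaneEquiv θ q ∈ (fun x => R • x) '' K ↔
      R⁻¹ • (p - q) ∈ rotatedCoords K θ := by
  have h : rotatedPlaneEquiv θ p - rotatedPlaneEquiv θ q =
      R • rotatedPlaneEquiv θ (R⁻¹ • (p - q)) := by
    simp only [rotatedPlaneEquiv_apply, ← rotateIso_apply, ← map_sub, ← map_smul]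
    congr 1
    apply plane_ext <;> simp [hR.ne']
  rw [h]
  constructor
  · rintro ⟨x, hx, hxe⟩
    have := smul_right_injective Plane hR.ne' hxe
    rw [this] at hx
    exact hx
  · intro hx
    exact ⟨_, hx, rfl⟩

theorem exists_lintegral_radialEnergy_ge {C : Set Plane} (hC : IsPlanarConvexBody C)
    {θ : AngleCircle} (hθ : θ ∉ angularTrace C) {η : ℝ} (hη : 0 < η) :
    ∃ c > 0, ∃ R₀ > 0, ∀ R ≥ R₀, ENNReal.ofReal (c * R ^ (-3 : ℤ)) ≤
      ∫⁻ φ in Metric.ball θ η, ENNReal.ofReal (radialEnergy (closure C) R φ) := by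
  obtain ⟨ε, hε, hsector⟩ := exists_ball_subset_sector θ hη
  have hKm : MeasurableSet (closure C) := isClosed_closure.measurableSet
  have hF := continuous_fourierIndicator hKm.nullMeasurableSet hC.bounded.closure
  let bump : ContDiffBump ((1 / 2 : ℝ) • unitVec θ) := ⟨ε / 2, ε, by positivity, by linarith⟩
  have hcomp : HasCompactSupport fun ξ => (bump ξ : ℂ) :=
    bump.hasCompactSupport.comp_left (g := Complex.ofReal) rfl
  set χ : SchwartzMap Plane ℂ :=
    hcomp.toSchwartzMap (Complex.ofRealCLM.contDiff.comp bump.contDiff) with hχdef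
  have hχ : ∀ ξ, χ ξ = (bump ξ : ℂ) := fun _ => rfl
  have hχ1 : ∀ ξ, ‖χ ξ‖ ≤ 1 := fun ξ => by
    rw [hχ, Complex.norm_real, Real.norm_of_nonneg bump.nonneg]; exact bump.le_one
  have hχsupp : ∀ ξ ∉ Metric.ball ((1 / 2 : ℝ) • unitVec θ) ε, χ ξ = 0 := fun ξ hξ => by
    rw [hχ, bump.zero_of_le_dist (by simpa using hξ), Complex.ofReal_zero]
  set v : SchwartzMap Plane ℂ := 𝓕⁻ χ with hv
  have hmp := measurePreserving_rotatedPlaneEquiv θ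
  set w : ℝ × ℝ → ℂ := fun p => v (rotatedPlaneEquiv θ p) with hw
  have hwc : Continuous w := v.continuous.comp (continuous_rotatedPlaneEquiv θ)
  have hwi : Integrable w :=
    (hmp.integrable_comp_emb (rotatedPlaneEquiv θ).measurableEmbedding).2 v.integrable
  -- In the rotated coordinates this is the character of frequency `unitVec θ / 2`; pairing it with
  -- `w` evaluates `χ` at the centre of the bump, where it is `1`.
  set e : ℝ → ℂ := fun s => Complex.exp (((-π * s : ℝ) : ℂ) * Complex.I) with he
  have hec : Continuous e := by fun_prop
  have hei : Integrable fun p : ℝ × ℝ => e p.2 * w p := by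
    refine hwi.norm.mono' ((hec.comp continuous_snd).mul hwc).aestronglyMeasurable
      (Filter.Eventually.of_forall fun p => ?_)
    rw [norm_mul, he, Complex.norm_exp_ofReal_mul_I, one_mul]
  have hne : ∫ p : ℝ × ℝ, e p.2 * w p ≠ 0 := by
    have h1 : (𝓕 (v : Plane → ℂ)) ((1 / 2 : ℝ) • unitVec θ) = 1 := by
      rw [← SchwartzMap.fourier_coe, hv, FourierTransform.fourier_fourierInv_eq, hχ,
        bump.one_of_mem_closedBall (Metric.mem_closedBall_self (by positivity)),
        Complex.ofReal_one]
    rw [Real.fourier_eq', ← hmp.integral_comp (rotatedPlaneEquiv θ).measurableEmbedding] at h1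
    have h2 : ∫ p : ℝ × ℝ, e p.2 * w p = 1 := by
      rw [← h1]
      congr 1
      ext p
      have h3 := inner_rotate_unitVec θ 0 p
      simp only [AddCircle.coe_zero, add_zero, Real.cos_zero, Real.sin_zero, mul_one, mul_zero,
        sub_zero] at h3
      rw [rotatedPlaneEquiv_apply, real_inner_smul_right, h3, smul_eq_mul]
      simp only [he, hw, rotatedPlaneEquiv_apply]
      congr 4
      ring
    rw [h2]
    exact one_ne_zero
  obtain ⟨t₀, ht₀⟩ := exists_halfPlane_integral_ne_zero hwi hne hei
  obtain ⟨s, hs, hlower⟩ := exists_lintegral_smoothed_ge hwi hwc.measurable ht₀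
  obtain ⟨a, b, δ, f, hab, hδ, hflat⟩ := exists_hasFlatGraph_of_notMem_angularTrace hC hθ hs
  have hK'm : MeasurableSet (rotatedCoords (closure C) θ) :=
    (isCompact_rotatedCoords hC.bounded.isCompact_closure θ).measurableSet
  obtain ⟨c, hc, R₀, hR₀, hR⟩ := hlower _ a b δ f hK'm hab hδ hflat
  refine ⟨c / 64, by positivity, R₀, hR₀, fun R hRR => ?_⟩
  have hR0 : 0 < R := lt_of_lt_of_le hR₀ hRR
  have hD : IsCompact ((fun x => R • x) '' closure C) :=
    hC.bounded.isCompact_closure.image (continuous_const_smul R)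
  have hplan := lintegral_enorm_sq_mul_fourierIndicator hD.measurableSet hD.isBounded χ
  have hleft : ∫⁻ ξ, ‖fourierIndicator ((fun x => R • x) '' closure C) ξ * χ ξ‖ₑ ^ 2 =
      ENNReal.ofReal (R ^ 4) * ∫⁻ ξ, ‖fourierIndicator (closure C) (R • ξ) * χ ξ‖ₑ ^ 2 := by
    rw [← lintegral_const_mul' _ _ ENNReal.ofReal_ne_top]
    refine lintegral_congr fun ξ => ?_
    rw [fourierIndicator_smul hR0, mul_assoc, enorm_mul, mul_pow, ← ofReal_norm, norm_pow,
      Complex.norm_real, Real.norm_of_nonneg hR0.le, ← ENNReal.ofReal_pow (by positivity),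
      ← pow_mul]
  have hright : ∫⁻ x, ‖∫ y in {y | x - y ∈ (fun x => R • x) '' closure C}, v y‖ₑ ^ 2 =
      ∫⁻ p : ℝ × ℝ, ‖∫ q in {q | R⁻¹ • (p - q) ∈ rotatedCoords (closure C) θ}, w q‖ₑ ^ 2 := by
    rw [← hmp.lintegral_comp_emb (rotatedPlaneEquiv θ).measurableEmbedding]
    refine lintegral_congr fun p => ?_
    rw [← hmp.setIntegral_preimage_emb (rotatedPlaneEquiv θ).measurableEmbedding]
    congr 4
    ext q
    exact rotatedPlaneEquiv_sub_mem_iff θ hR0 p q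
  rw [hleft, ← hv, hright] at hplan
  have hbump := lintegral_mul_bump_le hF hsector χ.continuous hχ1 hχsupp R
  have hmain : ENNReal.ofReal (c * R) ≤ ENNReal.ofReal (R ^ 4) *
      (64 * ∫⁻ φ in Metric.ball θ η, ENNReal.ofReal (radialEnergy (closure C) R φ)) := by
    refine (hR R hRR).trans (hplan.symm.le.trans ?_)
    gcongr
  have hsplit : ENNReal.ofReal (c * R) =
      (ENNReal.ofReal (R ^ 4) * 64) * ENNReal.ofReal (c / 64 * R ^ (-3 : ℤ)) := by
    rw [(ENNReal.ofReal_ofNat 64).symm, ← ENNReal.ofReal_mul (by positivity),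
      ← ENNReal.ofReal_mul (by positivity)]
    congr 1
    rw [zpow_neg]
    field_simp
  rw [hsplit, ← mul_assoc] at hmain
  refine (ENNReal.mul_le_mul_iff_right ?_ ?_).1 hmain
  · have : 0 < ENNReal.ofReal (R ^ 4) := ENNReal.ofReal_pos.2 (by positivity)
    exact mul_ne_zero this.ne' (by norm_num)
  · exact ENNReal.mul_ne_top ENNReal.ofReal_ne_top (by norm_num)

end RadialEnergy

/-! ### Arcs of the circle and the symmetric angular trace -/

section Arcs

lemma dist_coe_le (x y : ℝ) : dist (x : AngleCircle) (y : AngleCircle) ≤ |x - y| := by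
  rw [dist_eq_norm, ← AddCircle.coe_sub]
  exact QuotientAddGroup.norm_mk_le_norm

lemma ball_eq_image (m r : ℝ) :
    Metric.ball (m : AngleCircle) r = (fun t : ℝ => (t : AngleCircle)) '' Set.Ioo (m - r) (m + r) := by
  ext φ
  constructor
  · intro hφ
    rw [Metric.mem_ball, dist_eq_norm] at hφ
    obtain ⟨x, hx, hxr⟩ := QuotientAddGroup.norm_lt_iff.1 hφ
    rw [Real.norm_eq_abs, abs_lt] at hxr
    refine ⟨m + x, ⟨by linarith, by linarith⟩, ?_⟩
    have hx' : (x : AngleCircle) = φ - m := hx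
    simp only [AddCircle.coe_add, hx', add_sub_cancel]
  · rintro ⟨t, ht, rfl⟩
    refine (dist_coe_le t m).trans_lt ?_
    rw [abs_lt]
    constructor <;> linarith [ht.1, ht.2]

lemma isPreconnected_angle_ball (φ : AngleCircle) (r : ℝ) : IsPreconnected (Metric.ball φ r) := by
  induction φ using QuotientAddGroup.induction_on with
  | H m =>
    have h := (isPreconnected_Ioo (a := m - r) (b := m + r)).image
      (fun t : ℝ => (t : AngleCircle)) (AddCircle.continuous_mk' _).continuousOn
    rwa [← ball_eq_image] at h

lemma volume_angle_ball (φ : AngleCircle) {r : ℝ} (hr : r ≤ π) :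
    volume (Metric.ball φ r) = ENNReal.ofReal (2 * r) := by
  rw [← measure_congr AddCircle.closedBall_ae_eq_ball, AddCircle.volume_closedBall,
    min_eq_right (by linarith)]

/-- Wrapping onto the circle does not increase length, so `J` has two points more than `ψ` apart.
The radius is capped at `π`, beyond which a ball no longer has length `2 * r`; `hup` keeps `ψ` below
the capped length. -/
lemma IsAngleInterval.exists_ball_subset {I : Set AngleCircle} (hI : IsAngleInterval I)
    {ψ : ℝ≥0∞} (hlow : ψ < volume I) (hup : volume I ≤ ENNReal.ofReal (2 * π)) :
    ∃ (m r : ℝ), r ≤ π ∧ ψ < ENNReal.ofReal (2 * r) ∧ Metric.ball (m : AngleCircle) r ⊆ I := by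
  obtain ⟨J, hJ, rfl⟩ := hI
  have hψ : ψ ≠ ⊤ := (hlow.trans_le le_top).ne
  obtain ⟨x, hx, y, hy, hxy⟩ : ∃ x ∈ J, ∃ y ∈ J, ψ < ENNReal.ofReal (y - x) := by
    by_contra hall
    push Not at hall
    have hall' : ∀ x ∈ J, ∀ y ∈ J, y - x ≤ ψ.toReal := fun x hx y hy =>
      (ENNReal.ofReal_le_iff_le_toReal hψ).1 (hall x hx y hy)
    have hne : J.Nonempty := by
      rw [Set.nonempty_iff_ne_empty]
      rintro rfl
      simp at hlow
    obtain ⟨z, hz⟩ := hne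
    have hba : BddAbove J := ⟨z + ψ.toReal, fun y hy => by linarith [hall' z hz y hy]⟩
    have hbb : BddBelow J := ⟨z - ψ.toReal, fun y hy => by linarith [hall' y hy z hz]⟩
    have hlen : sSup J - sInf J ≤ ψ.toReal := by
      have h1 : ∀ x ∈ J, sSup J ≤ x + ψ.toReal := fun x hx =>
        csSup_le ⟨z, hz⟩ fun y hy => by linarith [hall' x hx y hy]
      have h2 : sSup J - ψ.toReal ≤ sInf J := le_csInf ⟨z, hz⟩ fun x hx => by linarith [h1 x hx]
      linarith
    have hsub : (fun t : ℝ => (t : AngleCircle)) '' J ⊆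
        Metric.closedBall (((sInf J + sSup J) / 2 : ℝ) : AngleCircle) (ψ.toReal / 2) := by
      rintro _ ⟨t, ht, rfl⟩
      refine (dist_coe_le _ _).trans ?_
      have h1 := csInf_le hbb ht
      have h2 := le_csSup hba ht
      rw [abs_le]
      constructor <;> linarith
    refine absurd hlow (not_lt.2 ((measure_mono hsub).trans ?_))
    rw [AddCircle.volume_closedBall]
    refine (ENNReal.ofReal_le_ofReal (min_le_right _ _)).trans ?_
    rw [mul_div_cancel₀ _ two_ne_zero, ENNReal.ofReal_toReal hψ]
  refine ⟨x + min ((y - x) / 2) π, min ((y - x) / 2) π, min_le_right _ _, ?_, ?_⟩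
  · rcases min_choice ((y - x) / 2) π with h | h
    · rw [h, mul_div_cancel₀ _ two_ne_zero]; exact hxy
    · rw [h]; exact hlow.trans_le hup
  · rw [ball_eq_image]
    refine Set.image_mono fun t ht => hJ.out hx hy ⟨by linarith [ht.1], ?_⟩
    linarith [ht.2, min_le_left ((y - x) / 2) π]

lemma isOpen_symmetricTrace (C : Set Plane) : IsOpen (symmetricTrace C) := by
  have h : IsOpen (angularTrace C) := isOpen_biUnion fun _ _ => isOpen_interior
  exact h.inter (isOpenMap_add_right _ _ h)

lemma exists_notMem_symmetricTrace {C : Set Plane} {r : ℝ} (hrπ : r ≤ π)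
    (hr : symmetricAngularThreshold C < ENNReal.ofReal (2 * r)) (φ : AngleCircle) :
    ∃ z ∈ Metric.ball φ r, z ∉ symmetricTrace C := by
  by_contra hall
  push Not at hall
  have hr0 : 0 < r := by
    have := ENNReal.ofReal_pos.1 (bot_lt_of_lt hr)
    linarith
  have hφ : φ ∈ Metric.ball φ r := Metric.mem_ball_self hr0
  have hsub := (isPreconnected_angle_ball φ r).subset_connectedComponentIn hφ hall
  have hle : volume (connectedComponentIn (symmetricTrace C) φ) ≤ symmetricAngularThreshold C :=
    le_iSup₂ (f := fun θ (_ : θ ∈ symmetricTrace C) =>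
      volume (connectedComponentIn (symmetricTrace C) θ)) φ (hall φ hφ)
  have := (measure_mono hsub).trans hle
  rw [volume_angle_ball φ hrπ] at this
  exact absurd hr (not_lt.2 this)

lemma notMem_symmetricTrace {C : Set Plane} {z : AngleCircle} (hz : z ∉ symmetricTrace C) :
    z ∉ angularTrace C ∨ z - ((π : ℝ) : AngleCircle) ∉ angularTrace C := by
  by_contra h
  push Not at h
  exact hz ⟨h.1, ⟨_, h.2, sub_add_cancel _ _⟩⟩

theorem exists_lintegral_radialEnergy_ge_of_notMem_symmetricTrace {C : Set Plane}
    (hC : IsPlanarConvexBody C) {z : AngleCircle} (hz : z ∉ symmetricTrace C) {η : ℝ}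
    (hη : 0 < η) :
    ∃ c > 0, ∃ R₀ > 0, ∀ R ≥ R₀, ENNReal.ofReal (c * R ^ (-3 : ℤ)) ≤
      ∫⁻ φ in Metric.ball z η, ENNReal.ofReal (radialEnergy (closure C) R φ) := by
  rcases notMem_symmetricTrace hz with h | h
  · exact exists_lintegral_radialEnergy_ge hC h hη
  · obtain ⟨c, hc, R₀, hR₀, hR⟩ := exists_lintegral_radialEnergy_ge hC h hη
    refine ⟨c, hc, R₀, hR₀, fun R hRR => (hR R hRR).trans (le_of_eq ?_)⟩
    have hmp := measurePreserving_add_right (volume : Measure AngleCircle) ((π : ℝ) : AngleCircle)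
    rw [← hmp.setLIntegral_comp_preimage_emb (measurableEmbedding_addRight _) _ (Metric.ball z η)]
    have hpre : (fun φ => φ + ((π : ℝ) : AngleCircle)) ⁻¹' Metric.ball z η =
        Metric.ball (z - ((π : ℝ) : AngleCircle)) η := by
      ext φ
      simp only [Set.mem_preimage, Metric.mem_ball, dist_eq_norm]
      rw [sub_sub_eq_add_sub]
    rw [hpre]
    simp only [radialEnergy_add_pi]

lemma exists_uniform_lower_bound {ι : Type*} {t : Set ι} (ht : t.Finite) {g : ι → ℝ → ℝ≥0∞}
    (h : ∀ x ∈ t, ∃ c > 0, ∃ R₀ > 0, ∀ R ≥ R₀, ENNReal.ofReal (c * R ^ (-3 : ℤ)) ≤ g x R) :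
    ∃ c > 0, ∃ R₀ > 0, ∀ x ∈ t, ∀ R ≥ R₀, ENNReal.ofReal (c * R ^ (-3 : ℤ)) ≤ g x R := by
  induction t, ht using Set.Finite.induction_on with
  | empty => exact ⟨1, one_pos, 1, one_pos, by simp⟩
  | @insert a t _ _ ih =>
    obtain ⟨c, hc, R₀, hR₀, hR⟩ := ih fun x hx => h x (Set.mem_insert_of_mem _ hx)
    obtain ⟨c', hc', R₁, hR₁, hR'⟩ := h a (Set.mem_insert _ _)
    refine ⟨min c c', lt_min hc hc', max R₀ R₁, lt_max_of_lt_left hR₀, fun x hx R hRR => ?_⟩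
    have hRpos : 0 < R := hR₀.trans_le ((le_max_left _ _).trans hRR)
    rcases Set.mem_insert_iff.1 hx with rfl | hx
    · refine le_trans (ENNReal.ofReal_le_ofReal ?_) (hR' R ((le_max_right _ _).trans hRR))
      gcongr
      exact min_le_right _ _
    · refine le_trans (ENNReal.ofReal_le_ofReal ?_) (hR x hx R ((le_max_left _ _).trans hRR))
      gcongr
      exact min_le_left _ _

theorem exists_lintegral_radialEnergy_ball_ge {C : Set Plane} (hC : IsPlanarConvexBody C) {r : ℝ}
    (hrπ : r ≤ π) (hr : symmetricAngularThreshold C < ENNReal.ofReal (2 * r)) :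
    ∃ c > 0, ∃ R₀ > 0, ∀ φ₀ : AngleCircle, ∀ R ≥ R₀, ENNReal.ofReal (c * R ^ (-3 : ℤ)) ≤
      ∫⁻ φ in Metric.ball φ₀ r, ENNReal.ofReal (radialEnergy (closure C) R φ) := by
  have htop : symmetricAngularThreshold C ≠ ⊤ := (hr.trans_le le_top).ne
  have hr' := (ENNReal.lt_ofReal_iff_toReal_lt htop).1 hr
  set ψ := (symmetricAngularThreshold C).toReal with hψ
  -- A ball of radius `r'` is still longer than the threshold, and the margin is split as `r' + 2 *
  -- η = r`: one `η` to reach a centre of the cover, one for the arc around it.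
  set r' := (ψ / 2 + r) / 2 with hr'def
  have hr'ψ : symmetricAngularThreshold C < ENNReal.ofReal (2 * r') :=
    (ENNReal.lt_ofReal_iff_toReal_lt htop).2 (by linarith)
  set η := (r - r') / 2 with hη
  have hη0 : 0 < η := by linarith
  obtain ⟨t, htB, htfin, hcover⟩ :=
    (isOpen_symmetricTrace C).isClosed_compl.isCompact.finite_cover_balls hη0
  obtain ⟨c, hc, R₀, hR₀, hR⟩ := exists_uniform_lower_bound htfin
    (g := fun z R => ∫⁻ φ in Metric.ball z η, ENNReal.ofReal (radialEnergy (closure C) R φ))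
    fun z hz => exists_lintegral_radialEnergy_ge_of_notMem_symmetricTrace hC (htB hz) hη0
  refine ⟨c, hc, R₀, hR₀, fun φ₀ R hRR => ?_⟩
  obtain ⟨z, hzball, hz⟩ := exists_notMem_symmetricTrace (by linarith) hr'ψ φ₀
  obtain ⟨x, hxt, hzx⟩ := Set.mem_iUnion₂.1 (hcover hz)
  refine (hR x hxt R hRR).trans (lintegral_mono_set fun φ hφ => ?_)
  rw [Metric.mem_ball] at *
  have h1 := dist_triangle φ x φ₀
  have h2 := dist_triangle_left x φ₀ z
  linarith

end Arcs

theorem lemma3p5 (C : Set Plane) (hC : IsPlanarConvexBody C)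
    (I : Set AngleCircle) (hI : IsAngleInterval I)
    (hlow : symmetricAngularThreshold C < volume I)
    (hup : volume I ≤ ENNReal.ofReal (2 * π)) :
    ∃ c₁ c₂ ρ₀ : ℝ, 0 < c₁ ∧ 0 < c₂ ∧ 0 < ρ₀ ∧
      ∀ ω : AngleCircle, ∀ ρ : ℝ, ρ₀ ≤ ρ →
        c₁ * ρ ^ (-3 : ℤ) ≤ fourierAverage C I ω ρ ∧
          fourierAverage C I ω ρ ≤ c₂ * ρ ^ (-3 : ℤ) := by
  obtain ⟨m, r, hrπ, hr, hball⟩ := hI.exists_ball_subset hlow hup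
  obtain ⟨c₁, hc₁, ρ₀, hρ₀, hlower⟩ := exists_lintegral_radialEnergy_ball_ge hC hrπ hr
  obtain ⟨B, hB⟩ := isBounded_iff_forall_norm_le.1 hC.bounded.closure
  have hKm : MeasurableSet (closure C) := isClosed_closure.measurableSet
  have hF := continuous_fourierIndicator hKm.nullMeasurableSet hC.bounded.closure
  have hB' : ∀ x ∈ closure C, ‖x‖ ≤ |B| + 1 := fun x hx =>
    (hB x hx).trans (by linarith [le_abs_self B])
  refine ⟨c₁, 4 * (|B| + 1), ρ₀, hc₁, by positivity, hρ₀, fun ω ρ hρ => ?_⟩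
  have hρ0 : 0 < ρ := hρ₀.trans_le hρ
  have hFC : fourierIndicator C = fourierIndicator (closure C) :=
    (fourierIndicator_congr_ae
      (closure_ae_eq_of_null_frontier (hC.convex.addHaar_frontier volume))).symm
  have hrad : radialEnergy C = radialEnergy (closure C) := by
    unfold radialEnergy; rw [hFC]
  rw [fourierAverage_eq, hrad]
  set g := radialEnergy (closure C) ρ with hg
  have hgc : Continuous g := continuous_radialEnergy hF ρ
  have hg0 : ∀ φ, 0 ≤ g φ := radialEnergy_nonneg _ _
  have hgω : Continuous fun θ => g (ω - θ) := hgc.comp (continuous_const.sub continuous_id)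
  have hint : IntegrableOn (fun θ => g (ω - θ)) I :=
    ((hgω.continuousOn.integrableOn_compact isCompact_univ).mono_set (Set.subset_univ I))
  have hof := ofReal_integral_eq_lintegral_ofReal hint (Filter.Eventually.of_forall fun θ => hg0 _)
  have hmp := Measure.measurePreserving_sub_left (volume : Measure AngleCircle) ω
  have hmeas : Measurable fun φ => ENNReal.ofReal (g φ) :=
    ENNReal.measurable_ofReal.comp hgc.measurable
  have hnn : 0 ≤ ∫ θ in I, g (ω - θ) := integral_nonneg fun θ => hg0 _
  constructor
  · rw [← ENNReal.ofReal_le_ofReal_iff hnn, hof]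
    -- The substitution `φ = ω - θ` carries the arc around `m` inside `I` to the arc around `ω - m`;
    -- the constants do not depend on its centre.
    refine (hlower (ω - m) ρ hρ).trans ?_
    rw [← hmp.setLIntegral_comp_preimage Metric.isOpen_ball.measurableSet hmeas]
    refine lintegral_mono_set (Set.Subset.trans (fun θ hθ => ?_) hball)
    rw [Set.mem_preimage, Metric.mem_ball, dist_sub_left] at hθ
    exact hθ
  · rw [← ENNReal.ofReal_le_ofReal_iff (by positivity), hof]
    refine (setLIntegral_le_lintegral _ _).trans ?_
    rw [hmp.lintegral_comp hmeas]
    exact lintegral_radialEnergy_le hC.convex.closure hKm hB' (by positivity) hρ0
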